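/- Let $M$ be an $m$-dimensional smooth manifold (without boundary, Hausdorff, second countable). A set of generators of a regular codimension-$k$ foliation $\mathcal F$ of $M$ is a family $\alpha_1,\dots,\alpha_k$ of smooth 1-forms on $M$ which are linearly independent at every point, satisfy the integrability conditions $d\alpha_i\wedge\mu=0$ $(i=1,\dots,k)$ with $\mu=\alpha_1\wedge\cdots\wedge\alpha_k$, and whose common kernel $\bigcap_i\ker\alpha_i$ is the tangent distribution of $\mathcal F$. Assume that $\mathcal F$ has such a set of generators. Two $r$-forms $\beta,\rho$ are called $\mathcal F$-equivalent if $(\beta-\rho)\wedge\mu=0$; let $\Lambda^r_{\mathcal F}(M)$ be the space of equivalence classes (foliated $r$-forms), $\pi:\Lambda^r(M)\to\Lambda^r_{\mathcal F}(M)$ the projection, and $d_{\mathcal F}(\pi(\beta))=\pi(d\beta)$ the foliated exterior derivative. The foliated cohomology is $\mathcal H^r_{\mathcal F}(M)=\ker(d_{\mathcal F}:\Lambda^r_{\mathcal F}\to\Lambda^{r+1}_{\mathcal F})/\operatorname{Im}(d_{\mathcal F}:\Lambda^{r-1}_{\mathcal F}\to\Lambda^{r}_{\mathcal F})$; write $[\,\cdot\,]_{\mathcal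 F}$ for cohomology classes. For every set of generators $\alpha_1,\dots,\alpha_k$ of $\mathcal F$ there are smooth vector fields $X^1,\dots,X^k$ on $M$ dual to it, i.e. $\alpha_i(X^j)=\delta_{ij}$. For every such choice of generators and dual vector fields put $\delta=-\sum_{i=1}^k L_{X^i}\alpha_i$. Then $\pi(\delta)$ is $d_{\mathcal F}$-closed, and the first obstruction class $C_{\mathcal F}=[\pi(\delta)]_{\mathcal F}\in\mathcal H^1_{\mathcal F}(M)$ vanishes if and only if there is a set of generators $\tilde\alpha_1,\dots,\tilde\alpha_k$ of the same foliation $\mathcal F$ such that $\tilde\alpha_1\wedge\cdots\wedge\tilde\alpha_k$ is closed. -/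

import Mathlib

open scoped Manifold ContDiff Topology

noncomputable section
namespace FoliatedForms

section Forms
variable (E : Type*) [NormedAddCommGroup E] [NormedSpace ℝ E]
  (M : Type*) [TopologicalSpace M] [ChartedSpace E M]

/-- A (not necessarily smooth) differential `n`-form on `M`: an alternating `n`-linear form on each
tangent space. -/
def RawForm (n : ℕ) : Type _ := (x : M) → TangentSpace 𝓘(ℝ, E) x [⋀^Fin n]→L[ℝ] ℝ

instance (n : ℕ) : AddCommGroup (RawForm E M n) :=
  inferInstanceAs (AddCommGroup ((x : M) → TangentSpace 𝓘(ℝ, E) x [⋀^Fin n]→L[ℝ] ℝ))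

instance (n : ℕ) : Module ℝ (RawForm E M n) :=
  inferInstanceAs (Module ℝ ((x : M) → TangentSpace 𝓘(ℝ, E) x [⋀^Fin n]→L[ℝ] ℝ))

variable {E M} {n : ℕ}

/-- The coordinate expression of a form in the preferred chart at `c`, i.e. its pullback under the
inverse of that chart (only meaningful on the target of the chart). -/
def RawForm.inChart (η : RawForm E M n) (c : M) : E → E [⋀^Fin n]→L[ℝ] ℝ := fun y =>
  (η ((extChartAt 𝓘(ℝ, E) c).symm y)).compContinuousLinearMap
    (mfderiv 𝓘(ℝ, E) 𝓘(ℝ, E) (extChartAt 𝓘(ℝ, E) c).symm y)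

/-- The exterior derivative, computed at each point in the preferred chart at that point. -/
def RawForm.d (η : RawForm E M n) : RawForm E M (n + 1) := fun x =>
  (extDeriv (η.inChart x) (extChartAt 𝓘(ℝ, E) x x)).compContinuousLinearMap
    (mfderiv 𝓘(ℝ, E) 𝓘(ℝ, E) (extChartAt 𝓘(ℝ, E) x) x)

/-- The interior product `i_X η = η(X, ·, …, ·)`. -/
def RawForm.interior (X : (x : M) → TangentSpace 𝓘(ℝ, E) x) (η : RawForm E M (n + 1)) :
    RawForm E M n := fun x => ContinuousAlternatingMap.curryLeft (E := E) (η x) (X x)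

variable (E M n)

/-- Smooth differential `n`-forms on `M`: those whose coordinate expressions are smooth. -/
def Form : Submodule ℝ (RawForm E M n) where
  carrier := {η | ∀ c : M, ContDiffOn ℝ ∞ (η.inChart c) (extChartAt 𝓘(ℝ, E) c).target}
  zero_mem' := by
    intro c
    have : RawForm.inChart (0 : RawForm E M n) c = 0 := by
      ext y v; rfl
    rw [this]; exact contDiffOn_const
  add_mem' := by
    intro a b ha hb c
    have : RawForm.inChart (a + b) c = RawForm.inChart a c + RawForm.inChart b c := by
      ext y v; rfl
    rw [this]; exact (ha c).add (hb c)
  smul_mem' := by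
    intro r a ha c
    have : RawForm.inChart (r • a) c = r • RawForm.inChart a c := by
      ext y v; rfl
    rw [this]; exact (ha c).const_smul r

variable {E M n}

theorem differentiableAt_inChart (η : Form E M n) (x : M) :
    DifferentiableAt ℝ (RawForm.inChart η.1 x) (extChartAt 𝓘(ℝ, E) x x) :=
  ((η.2 x).contDiffAt ((isOpen_extChartAt_target x).mem_nhds
    (mem_extChartAt_target x))).differentiableAt (by simp)

theorem compContinuousLinearMap_congr_point (η : RawForm E M n) {p q : M} (h : p = q)
    {A B : E →L[ℝ] E} (hAB : A = B) :
    (ContinuousAlternatingMap.compContinuousLinearMap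
      (η p : E [⋀^Fin n]→L[ℝ] ℝ) A : E [⋀^Fin n]→L[ℝ] ℝ) =
      ContinuousAlternatingMap.compContinuousLinearMap (η q : E [⋀^Fin n]→L[ℝ] ℝ) B := by
  subst h; subst hAB; rfl

section
variable [IsManifold 𝓘(ℝ, E) ∞ M]

/-- The differential of a preferred chart, as an endomorphism of the model space. -/
def chartD (E : Type*) [NormedAddCommGroup E] [NormedSpace ℝ E]
    {M : Type*} [TopologicalSpace M] [ChartedSpace E M] (c x : M) : E →L[ℝ] E := mfderiv 𝓘(ℝ, E) 𝓘(ℝ, E) (extChartAt 𝓘(ℝ, E) c) x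

/-- The differential of the inverse of a preferred chart. -/
def chartSymmD (c : M) (y : E) : E →L[ℝ] E :=
  mfderiv 𝓘(ℝ, E) 𝓘(ℝ, E) (extChartAt 𝓘(ℝ, E) c).symm y

theorem contMDiffAt_extChartAt_symm' (c : M) {y : E}
    (hy : y ∈ (extChartAt 𝓘(ℝ, E) c).target) :
    ContMDiffAt 𝓘(ℝ, E) 𝓘(ℝ, E) ∞ (extChartAt 𝓘(ℝ, E) c).symm y :=
  (contMDiffOn_extChartAt_symm c).contMDiffAt ((isOpen_extChartAt_target c).mem_nhds hy)

theorem hasMFDerivAt_extChartAt_symm (c : M) {y : E}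
    (hy : y ∈ (extChartAt 𝓘(ℝ, E) c).target) :
    HasMFDerivAt 𝓘(ℝ, E) 𝓘(ℝ, E) (extChartAt 𝓘(ℝ, E) c).symm y
      (mfderiv 𝓘(ℝ, E) 𝓘(ℝ, E) (extChartAt 𝓘(ℝ, E) c).symm y) :=
  ((contMDiffAt_extChartAt_symm' c hy).mdifferentiableAt (by simp)).hasMFDerivAt

theorem hasMFDerivAt_extChartAt' (c : M) {x : M} (hx : x ∈ (extChartAt 𝓘(ℝ, E) c).source) :
    HasMFDerivAt 𝓘(ℝ, E) 𝓘(ℝ, E) (extChartAt 𝓘(ℝ, E) c) x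
      (mfderiv 𝓘(ℝ, E) 𝓘(ℝ, E) (extChartAt 𝓘(ℝ, E) c) x) :=
  ((contMDiffAt_extChartAt' (n := ∞) (by simpa using hx)).mdifferentiableAt (by simp)).hasMFDerivAt

theorem hasFDerivAt_chartChange (c x : M) {y : E}
    (hy : y ∈ (extChartAt 𝓘(ℝ, E) c).target)
    (hx : (extChartAt 𝓘(ℝ, E) c).symm y ∈ (extChartAt 𝓘(ℝ, E) x).source) :
    HasFDerivAt (extChartAt 𝓘(ℝ, E) x ∘ (extChartAt 𝓘(ℝ, E) c).symm)
      (chartD E x ((extChartAt 𝓘(ℝ, E) c).symm y) ∘L chartSymmD c y) y :=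
  ((hasMFDerivAt_extChartAt' x hx).comp y (hasMFDerivAt_extChartAt_symm c hy)).hasFDerivAt

theorem inChart_eventuallyEq (η : RawForm E M n) (c x : M) {y : E}
    (hy : y ∈ (extChartAt 𝓘(ℝ, E) c).target)
    (hx : (extChartAt 𝓘(ℝ, E) c).symm y ∈ (extChartAt 𝓘(ℝ, E) x).source) :
    η.inChart c =ᶠ[𝓝 y] fun z =>
      (η.inChart x ((extChartAt 𝓘(ℝ, E) x ∘ (extChartAt 𝓘(ℝ, E) c).symm) z)).compContinuousLinearMap
        (fderiv ℝ (extChartAt 𝓘(ℝ, E) x ∘ (extChartAt 𝓘(ℝ, E) c).symm) z) := by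
  have h1 : ∀ᶠ z in 𝓝 y, z ∈ (extChartAt 𝓘(ℝ, E) c).target :=
    (isOpen_extChartAt_target c).mem_nhds hy
  have h2 : ∀ᶠ z in 𝓝 y, (extChartAt 𝓘(ℝ, E) c).symm z ∈ (extChartAt 𝓘(ℝ, E) x).source :=
    (continuousOn_extChartAt_symm c).continuousAt
      ((isOpen_extChartAt_target c).mem_nhds hy)
      ((isOpen_extChartAt_source x).mem_nhds hx)
  filter_upwards [h1, h2, h2.eventually_nhds] with z hz hz' hz2
  have hlin : (extChartAt 𝓘(ℝ, E) x).symm (extChartAt 𝓘(ℝ, E) x ((extChartAt 𝓘(ℝ, E) c).symm z)) =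
      (extChartAt 𝓘(ℝ, E) c).symm z := (extChartAt 𝓘(ℝ, E) x).left_inv hz'
  have hφ := hasFDerivAt_chartChange c x hz hz'
  have hT : (extChartAt 𝓘(ℝ, E) x ∘ (extChartAt 𝓘(ℝ, E) c).symm) z ∈
      (extChartAt 𝓘(ℝ, E) x).target := (extChartAt 𝓘(ℝ, E) x).map_source hz'
  have hcomp := (hasMFDerivAt_extChartAt_symm x hT).comp z hφ.hasMFDerivAt
  have heq : (extChartAt 𝓘(ℝ, E) c).symm =ᶠ[𝓝 z] (extChartAt 𝓘(ℝ, E) x).symm ∘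
      (extChartAt 𝓘(ℝ, E) x ∘ (extChartAt 𝓘(ℝ, E) c).symm) := by
    filter_upwards [hz2] with w hw
    exact ((extChartAt 𝓘(ℝ, E) x).left_inv hw).symm
  have hd := (hcomp.congr_of_eventuallyEq heq).mfderiv
  rw [hφ.fderiv]
  exact compContinuousLinearMap_congr_point η hlin.symm hd

theorem inChart_d (η : Form E M n) (c : M) {y : E} (hy : y ∈ (extChartAt 𝓘(ℝ, E) c).target) :
    (RawForm.d η.1).inChart c y = extDeriv (RawForm.inChart η.1 c) y := by
  have hx : (extChartAt 𝓘(ℝ, E) c).symm y ∈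
      (extChartAt 𝓘(ℝ, E) ((extChartAt 𝓘(ℝ, E) c).symm y)).source := mem_extChartAt_source _
  have hφ := hasFDerivAt_chartChange c _ hy hx
  have hT := (extChartAt 𝓘(ℝ, E) ((extChartAt 𝓘(ℝ, E) c).symm y)).map_source hx
  have hsm : ContDiffAt ℝ ∞ (extChartAt 𝓘(ℝ, E) ((extChartAt 𝓘(ℝ, E) c).symm y) ∘
      (extChartAt 𝓘(ℝ, E) c).symm) y :=
    ((contMDiffAt_extChartAt (n := ∞)).comp y (contMDiffAt_extChartAt_symm' c hy)).contDiffAt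
  rw [(inChart_eventuallyEq η.1 c _ hy hx).extDeriv_eq, extDeriv_pullback (r := ∞) _ hsm (by
      simp only [minSmoothness_of_isRCLikeNormedField]
      exact WithTop.coe_le_coe.2 (le_top : (2 : ℕ∞) ≤ ⊤)),
    hφ.fderiv]
  · rfl
  · exact ((η.2 _).contDiffAt ((isOpen_extChartAt_target _).mem_nhds hT)).differentiableAt
      (by simp)

/-- The exterior derivative `d : Ω^n(M) → Ω^{n+1}(M)`. -/
def Form.d : Form E M n →ₗ[ℝ] Form E M (n + 1) where
  toFun η := ⟨RawForm.d η.1, fun c => by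
    have h := η.2 c
    have h2 : ContDiffOn ℝ ∞ (fderiv ℝ (RawForm.inChart η.1 c)) (extChartAt 𝓘(ℝ, E) c).target :=
      h.fderiv_of_isOpen (isOpen_extChartAt_target c) (by simp)
    have h3 := (ContinuousAlternatingMap.alternatizeUncurryFinCLM ℝ E ℝ
      (n := n)).contDiff.comp_contDiffOn h2
    exact h3.congr fun y hy => inChart_d η c hy⟩
  map_add' a b := by
    apply Subtype.ext
    funext x
    have h := extDeriv_add (differentiableAt_inChart a x) (differentiableAt_inChart b x)
    exact congrArg (fun T : E [⋀^Fin (n + 1)]→L[ℝ] ℝ => T.compContinuousLinearMap (M := E)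
      (mfderiv 𝓘(ℝ, E) 𝓘(ℝ, E) (extChartAt 𝓘(ℝ, E) x) x : E →L[ℝ] E)) h
  map_smul' r a := by
    apply Subtype.ext
    funext x
    have h := extDeriv_smul (x := extChartAt 𝓘(ℝ, E) x x) r (RawForm.inChart a.1 x)
    exact congrArg (fun T : E [⋀^Fin (n + 1)]→L[ℝ] ℝ => T.compContinuousLinearMap (M := E)
      (mfderiv 𝓘(ℝ, E) 𝓘(ℝ, E) (extChartAt 𝓘(ℝ, E) x) x : E →L[ℝ] E)) h

theorem isInvertible_mfderiv_extChartAt_symm (c : M) {y : E}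
    (hy : y ∈ (extChartAt 𝓘(ℝ, E) c).target) :
    (mfderiv 𝓘(ℝ, E) 𝓘(ℝ, E) (extChartAt 𝓘(ℝ, E) c).symm y).IsInvertible := by
  have : IsManifold 𝓘(ℝ, E) 1 M := IsManifold.of_le (n := ∞) (by simp)
  have h := isInvertible_mfderivWithin_extChartAt_symm (I := 𝓘(ℝ, E)) hy
  rwa [ModelWithCorners.range_eq_univ, mfderivWithin_univ] at h

variable [CompleteSpace E]

/-- The interior product of a smooth form with a smooth vector field. -/
def Form.interior (X : Cₛ^∞⟮𝓘(ℝ, E); E, (TangentSpace 𝓘(ℝ, E) : M → Type _)⟯)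
    (η : Form E M (n + 1)) : Form E M n :=
  ⟨RawForm.interior X η.1, by
    intro c
    have : IsManifold 𝓘(ℝ, E) 1 M := IsManifold.of_le (n := ∞) (by simp)
    have hX : ContDiffOn ℝ ∞ (VectorField.mpullback 𝓘(ℝ, E) 𝓘(ℝ, E)
        (extChartAt 𝓘(ℝ, E) c).symm X : E → E) (extChartAt 𝓘(ℝ, E) c).target := by
      intro y hy
      have h := ContMDiffAt.mpullback_vectorField_preimage (m := ∞) (n := ∞)
        (X.contMDiff ((extChartAt 𝓘(ℝ, E) c).symm y)) (contMDiffAt_extChartAt_symm' c hy)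
        (isInvertible_mfderiv_extChartAt_symm c hy) (by simp)
      exact (contMDiffAt_vectorSpace_iff_contDiffAt.1 h).contDiffWithinAt
    have h2 : ContDiffOn ℝ ∞ (fun y => (RawForm.inChart η.1 c y).curryLeft)
        (extChartAt 𝓘(ℝ, E) c).target := by
      have hL : ContDiff ℝ ∞ (ContinuousAlternatingMap.curryLeft :
          (E [⋀^Fin (n + 1)]→L[ℝ] ℝ) → (E →L[ℝ] (E [⋀^Fin n]→L[ℝ] ℝ))) :=
        LinearIsometry.contDiff (𝕜 := ℝ) (E := E [⋀^Fin (n + 1)]→L[ℝ] ℝ)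
          (F := E →L[ℝ] (E [⋀^Fin n]→L[ℝ] ℝ)) ContinuousAlternatingMap.curryLeftLI
      exact hL.comp_contDiffOn (η.2 c)
    refine (h2.clm_apply hX).congr fun y hy => ?_
    have hinv := congrArg (fun A => A (X ((extChartAt 𝓘(ℝ, E) c).symm y)))
      (isInvertible_mfderiv_extChartAt_symm c hy).self_comp_inverse
    ext v
    change (η.1 ((extChartAt 𝓘(ℝ, E) c).symm y) : E [⋀^Fin (n + 1)]→L[ℝ] ℝ)
        (Matrix.vecCons (X ((extChartAt 𝓘(ℝ, E) c).symm y) : E) (chartSymmD c y ∘ v)) =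
      (η.1 ((extChartAt 𝓘(ℝ, E) c).symm y) : E [⋀^Fin (n + 1)]→L[ℝ] ℝ)
        (chartSymmD c y ∘ Matrix.vecCons
          (VectorField.mpullback 𝓘(ℝ, E) 𝓘(ℝ, E) (extChartAt 𝓘(ℝ, E) c).symm X y : E) v)
    congr 1
    funext i
    refine Fin.cases ?_ (fun i => ?_) i
    · exact hinv.symm
    · rfl⟩

/-- The Lie derivative of a form of positive degree along a smooth vector field, by Cartan's formula
`L_X = i_X d + d i_X`. -/
def Form.lieDerivative (X : Cₛ^∞⟮𝓘(ℝ, E); E, (TangentSpace 𝓘(ℝ, E) : M → Type _)⟯)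
    (η : Form E M (n + 1)) : Form E M (n + 1) :=
  interior X (d η) + d (interior X η)

end


/-- The exterior product `a₁ ∧ ⋯ ∧ a_k` of covectors: `(v₁, …, v_k) ↦ det (a_i(v_j))`. Covectors are
regarded as alternating forms in one variable. -/
def wedgeCovectors {V : Type*} [AddCommGroup V] [Module ℝ V] [TopologicalSpace V] {k : ℕ}
    (a : Fin k → V [⋀^Fin 1]→L[ℝ] ℝ) : V [⋀^Fin k]→L[ℝ] ℝ :=
  { (Matrix.detRowAlternating (R := ℝ) (n := Fin k)).compLinearMap (LinearMap.pi fun i =>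
      ((ContinuousAlternatingMap.ofSubsingleton ℝ V ℝ (0 : Fin 1)).symm (a i)).toLinearMap) with
    cont := by
      change Continuous fun v : Fin k → V => Matrix.det (Matrix.of fun j i => a i fun _ => v j)
      refine Continuous.matrix_det (continuous_matrix fun j i => ?_)
      exact (a i).cont.comp (continuous_pi fun _ => continuous_apply j) }

theorem wedgeCovectors_apply {V : Type*} [AddCommGroup V] [Module ℝ V] [TopologicalSpace V]
    {k : ℕ} (a : Fin k → V [⋀^Fin 1]→L[ℝ] ℝ) (v : Fin k → V) :
    wedgeCovectors a v = Matrix.det (Matrix.of fun j i => a i fun _ => v j) := rfl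

/-- Alternatization, as a continuous linear map. -/
def altCLM (E : Type*) [NormedAddCommGroup E] [NormedSpace ℝ E] (k : ℕ) : ContinuousMultilinearMap ℝ (fun _ : Fin k => E) ℝ →L[ℝ] E [⋀^Fin k]→L[ℝ] ℝ :=
  AlternatingMap.mkContinuousLinear
    { toFun := fun f => f.toMultilinearMap.alternatization
      map_add' := fun f g => by ext v; simp [MultilinearMap.alternatization_apply]
      map_smul' := fun r f => by
        ext v
        simp only [MultilinearMap.alternatization_apply, AlternatingMap.smul_apply,
          Finset.smul_sum, RingHom.id_apply]
        exact Finset.sum_congr rfl fun σ _ => smul_comm (Equiv.Perm.sign σ) r _ }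
    (k.factorial : ℝ) (fun f v => by
      simp only [LinearMap.coe_mk, AddHom.coe_mk, MultilinearMap.alternatization_apply]
      refine (norm_sum_le _ _).trans ?_
      have h : ∀ σ : Equiv.Perm (Fin k), ‖Equiv.Perm.sign σ •
          f.toMultilinearMap.domDomCongr σ v‖ ≤ ‖f‖ * ∏ i, ‖v i‖ := fun σ => by
        rw [← Equiv.prod_comp σ, Units.smul_def, norm_isUnit_zsmul _ (Equiv.Perm.sign σ).isUnit]
        exact f.le_opNorm _
      refine (Finset.sum_le_sum fun σ _ => h σ).trans ?_
      simp [Fintype.card_perm, mul_assoc])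

/-- The smooth `k`-form `α₁ ∧ ⋯ ∧ α_k`. -/
def Form.wedge {k : ℕ} (α : Fin k → Form E M 1) : Form E M k :=
  ⟨fun x => wedgeCovectors fun i => (α i).1 x, fun c => by
    let P : ContinuousMultilinearMap ℝ (fun _ : Fin k => E →L[ℝ] ℝ)
        (E [⋀^Fin k]→L[ℝ] ℝ) :=
      ((altCLM E k).comp (ContinuousLinearMap.apply ℝ _
        (ContinuousMultilinearMap.mkPiAlgebra ℝ (Fin k) ℝ))).compContinuousMultilinearMap
        (ContinuousMultilinearMap.compContinuousLinearMapContinuousMultilinear ℝ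
          (fun _ : Fin k => E) (fun _ => ℝ) ℝ)
    have hP : ContDiff ℝ ∞ P := P.contDiff
    let S : (E [⋀^Fin 1]→L[ℝ] ℝ) →L[ℝ] (E →L[ℝ] ℝ) :=
      (ContinuousAlternatingMap.ofSubsingletonLIE (𝕜 := ℝ) (E := E) (F := ℝ) (0 : Fin 1)).symm.toContinuousLinearEquiv
    have hS : ContDiff ℝ ∞ S := S.contDiff
    have h : ContDiffOn ℝ ∞ (fun y i => S (RawForm.inChart (α i).1 c y))
        (extChartAt 𝓘(ℝ, E) c).target :=
      contDiffOn_pi.2 fun i => hS.comp_contDiffOn ((α i).2 c)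
    refine (hP.comp_contDiffOn h).congr fun y hy => ?_
    ext v
    change Matrix.det (Matrix.of fun j i => RawForm.inChart (α i).1 c y fun _ => v j) =
      MultilinearMap.alternatization _ v
    rw [MultilinearMap.alternatization_apply, Matrix.det_apply]
    refine Finset.sum_congr rfl fun σ _ => ?_
    simp [S]⟩

/-- The exterior product of alternating forms on a vector space (sum over shuffles). -/
def wedgeAt {V : Type*} [AddCommGroup V] [Module ℝ V] [TopologicalSpace V] {r s : ℕ}
    (β : V [⋀^Fin r]→L[ℝ] ℝ) (γ : V [⋀^Fin s]→L[ℝ] ℝ) : V [⋀^Fin (r + s)]→ₗ[ℝ] ℝ :=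
  ((LinearMap.mul' ℝ ℝ).compAlternatingMap
    (β.toAlternatingMap.domCoprod γ.toAlternatingMap)).domDomCongr finSumFinEquiv

section
variable {V : Type*} [AddCommGroup V] [Module ℝ V] [TopologicalSpace V] {r s : ℕ}

theorem wedgeAt_zero_left (γ : V [⋀^Fin s]→L[ℝ] ℝ) :
    wedgeAt (0 : V [⋀^Fin r]→L[ℝ] ℝ) γ = 0 := by
  have h : (0 : V [⋀^Fin r]→ₗ[ℝ] ℝ).domCoprod γ.toAlternatingMap = 0 := by
    rw [← AlternatingMap.domCoprod'_apply, TensorProduct.zero_tmul, map_zero]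
  ext v
  exact congrArg (fun T => LinearMap.mul' ℝ ℝ (T fun i => v (finSumFinEquiv i))) h

theorem wedgeAt_add_left (β β' : V [⋀^Fin r]→L[ℝ] ℝ) (γ : V [⋀^Fin s]→L[ℝ] ℝ) :
    wedgeAt (β + β') γ = wedgeAt β γ + wedgeAt β' γ := by
  have h : (β.toAlternatingMap + β'.toAlternatingMap).domCoprod γ.toAlternatingMap =
      β.toAlternatingMap.domCoprod γ.toAlternatingMap +
        β'.toAlternatingMap.domCoprod γ.toAlternatingMap := by
    simp only [← AlternatingMap.domCoprod'_apply, TensorProduct.add_tmul, map_add]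
  ext v
  exact (congrArg (fun T => LinearMap.mul' ℝ ℝ (T fun i => v (finSumFinEquiv i))) h).trans
    (map_add (LinearMap.mul' ℝ ℝ) _ _)

theorem wedgeAt_smul_left (c : ℝ) (β : V [⋀^Fin r]→L[ℝ] ℝ) (γ : V [⋀^Fin s]→L[ℝ] ℝ) :
    wedgeAt (c • β) γ = c • wedgeAt β γ := by
  have h : (c • β.toAlternatingMap).domCoprod γ.toAlternatingMap =
      c • β.toAlternatingMap.domCoprod γ.toAlternatingMap := by
    simp only [← AlternatingMap.domCoprod'_apply, ← TensorProduct.smul_tmul', map_smul]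
  ext v
  exact (congrArg (fun T => LinearMap.mul' ℝ ℝ (T fun i => v (finSumFinEquiv i))) h).trans
    (map_smul (LinearMap.mul' ℝ ℝ) _ _)

end
end Forms

section Foliations
variable {E : Type*} [NormedAddCommGroup E] [NormedSpace ℝ E]
  {M : Type*} [TopologicalSpace M] [ChartedSpace E M] [IsManifold 𝓘(ℝ, E) ∞ M] {k : ℕ}

/-- The 1-forms `α₁, …, α_k` are generators of the codimension-`k` foliation whose leaves are tangent
to `F`: they are independent at every point, satisfy `dα_i ∧ μ = 0` with `μ = α₁ ∧ ⋯ ∧ α_k`, and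
their common kernel is `F`. -/
structure IsGenerators (F : (x : M) → Submodule ℝ (TangentSpace 𝓘(ℝ, E) x))
    (α : Fin k → Form E M 1) : Prop where
  independent : ∀ x, LinearIndependent ℝ fun i => (α i).1 x
  integrable : ∀ i x, wedgeAt ((Form.d (α i)).1 x) ((Form.wedge α).1 x) = 0
  mem_iff : ∀ (x : M) (v : TangentSpace 𝓘(ℝ, E) x), v ∈ F x ↔ ∀ i, (α i).1 x (fun _ => v) = 0

/-- The vector fields `X¹, …, X^k` are dual to `α₁, …, α_k`: `α_i(X^j) = δ_ij`. -/
def IsDual (α : Fin k → Form E M 1)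
    (X : Fin k → Cₛ^∞⟮𝓘(ℝ, E); E, (TangentSpace 𝓘(ℝ, E) : M → Type _)⟯) : Prop :=
  ∀ (i j : Fin k) (x : M), (α i).1 x (fun _ => X j x) = if i = j then 1 else 0

/-- The `r`-forms `β` with `β ∧ μ = 0`, where `μ = α₁ ∧ ⋯ ∧ α_k`. Two `r`-forms are
`F`-equivalent when their difference is of this kind. -/
def nullForms (α : Fin k → Form E M 1) (r : ℕ) : Submodule ℝ (Form E M r) where
  carrier := {β | ∀ x, wedgeAt (β.1 x) ((Form.wedge α).1 x) = 0}
  zero_mem' := fun x => wedgeAt_zero_left _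
  add_mem' := fun {a b} ha hb x =>
    (wedgeAt_add_left (a.1 x) (b.1 x) _).trans (by rw [ha x, hb x, add_zero])
  smul_mem' := fun c a ha x =>
    (wedgeAt_smul_left c (a.1 x) _).trans (by rw [ha x, smul_zero])

/-- Foliated `r`-forms `Λ_F^r(M)`: classes of `r`-forms modulo `F`-equivalence. -/
abbrev FoliatedForm (α : Fin k → Form E M 1) (r : ℕ) : Type _ := Form E M r ⧸ nullForms α r

/-- The projection `π` from forms to foliated forms. -/
abbrev toFoliated (α : Fin k → Form E M 1) (r : ℕ) : Form E M r →ₗ[ℝ] FoliatedForm α r :=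
  (nullForms α r).mkQ

/-- The kernel of the foliated differential `d_F (π β) = π (d β)` in degree `r`: all classes `π β`
with `π (d β) = 0`. -/
def foliatedCocycles (α : Fin k → Form E M 1) (r : ℕ) : Submodule ℝ (FoliatedForm α r) :=
  (LinearMap.ker (toFoliated α (r + 1) ∘ₗ Form.d)).map (toFoliated α r)

/-- The image of the foliated differential `d_F (π φ) = π (d φ)` in degree `r + 1`: all classes
`π (d φ)`. -/
def foliatedCoboundaries (α : Fin k → Form E M 1) (r : ℕ) :
    Submodule ℝ (FoliatedForm α (r + 1)) :=
  LinearMap.range (toFoliated α (r + 1) ∘ₗ Form.d)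

/-- Foliated cohomology in degree `r + 1`. -/
abbrev FoliatedCohomology (α : Fin k → Form E M 1) (r : ℕ) : Type _ :=
  foliatedCocycles α (r + 1) ⧸ (foliatedCoboundaries α r).submoduleOf (foliatedCocycles α (r + 1))

variable [CompleteSpace E]

/-- The 1-form `δ = -∑ L_{X^i} α_i`. -/
def deltaForm (α : Fin k → Form E M 1)
    (X : Fin k → Cₛ^∞⟮𝓘(ℝ, E); E, (TangentSpace 𝓘(ℝ, E) : M → Type _)⟯) : Form E M 1 :=
  -∑ i, Form.lieDerivative (X i) (α i)

/-- The first obstruction class `[π(δ)]_F` in the first foliated cohomology. -/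
def obstructionClass (α : Fin k → Form E M 1)
    (X : Fin k → Cₛ^∞⟮𝓘(ℝ, E); E, (TangentSpace 𝓘(ℝ, E) : M → Type _)⟯)
    (h : toFoliated α 1 (deltaForm α X) ∈ foliatedCocycles α 1) : FoliatedCohomology α 0 :=
  Submodule.Quotient.mk ⟨toFoliated α 1 (deltaForm α X), h⟩

end Foliations
end FoliatedForms
end

/-!
Throughout, `μ = α₁ ∧ ⋯ ∧ α_k` and `F = ⋂ ker α_i`.

The linear algebra behind the theorem is that `β ∧ μ = 0` exactly when `β` vanishes on vectors of
`F` (`wedgeAt_wedgeCovectors_eq_zero_iff`): two forms are equivalent when they agree along the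
leaves. All questions about foliated forms become questions about restrictions to `F`, which are
then settled in charts (`mem_nullForms_iff_inChart`).

Because `α_i(X^i) = 1`, Cartan's formula gives `δ = -∑ i_{X^i} dα_i`, that is
`δ(u) = ∑ dα_i(u, X^i)`. Two local computations carry the argument.

* `extDeriv_delta_eq_zero`: `dδ` vanishes on `F`. Differentiating `α_j(X^i) = δ_ij` and
  `dα_i = 0` on `F`, and using `ddα_i = 0`, one finds for `u, v ∈ F` that `dδ(u, v)` is
  `∑ (dα_i(u, X^j) dα_j(v, X^i) - dα_i(v, X^j) dα_j(u, X^i))`, the trace of a commutator.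
* `extDeriv_smul_wedgeCovectors_cons`: for a function `g` and `u ∈ F`, the contraction of `d(g μ)`
  with `u` is `(dg + g δ)(u) μ`. The differential of `μ` in the direction `z` is the derivation
  induced by the endomorphism `v ↦ ∑ (D_z α_i)(v) X^i`; antisymmetrizing yields the endomorphism
  `v ↦ ∑ dα_i(u, v) X^i`, which kills `F` and has trace `δ(u)`.

A `(k+1)`-form whose contractions with `F` vanish is zero, so `g μ` is closed iff `dg + g δ = 0`
along `F` (`d_wedge_eq_zero_iff`). If `δ = dφ` along `F`, then `g = e^{-φ}` works and is realized by
rescaling one generator. Conversely the product of any other generators of the same foliation is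
`h μ` with `h` nowhere zero, and if it is closed then `δ = -d log |h|` along `F`.

Dual vector fields exist locally by inverting a matrix of smooth functions, and globally by a
partition of unity, since duality is an affine condition (`exists_isDual`).
-/

namespace FoliatedForms

/-! ### Linear algebra of covectors and their common kernel -/

section Pointwise

variable {V : Type*} [AddCommGroup V] [Module ℝ V] [TopologicalSpace V] {k r : ℕ}

theorem oneForm_add (a : V [⋀^Fin 1]→L[ℝ] ℝ) (u v : V) :
    (a fun _ => u + v) = (a fun _ => u) + a fun _ => v :=
  map_add ((ContinuousAlternatingMap.ofSubsingleton ℝ V ℝ (0 : Fin 1)).symm a) u v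

theorem oneForm_smul (a : V [⋀^Fin 1]→L[ℝ] ℝ) (c : ℝ) (v : V) :
    (a fun _ => c • v) = c * a fun _ => v :=
  map_smul ((ContinuousAlternatingMap.ofSubsingleton ℝ V ℝ (0 : Fin 1)).symm a) c v

theorem oneForm_sub (a : V [⋀^Fin 1]→L[ℝ] ℝ) (u v : V) :
    (a fun _ => u - v) = (a fun _ => u) - a fun _ => v :=
  map_sub ((ContinuousAlternatingMap.ofSubsingleton ℝ V ℝ (0 : Fin 1)).symm a) u v

theorem oneForm_sum {ι : Type*} (s : Finset ι) (a : V [⋀^Fin 1]→L[ℝ] ℝ) (v : ι → V) :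
    (a fun _ => ∑ i ∈ s, v i) = ∑ i ∈ s, a fun _ => v i :=
  map_sum ((ContinuousAlternatingMap.ofSubsingleton ℝ V ℝ (0 : Fin 1)).symm a) v s

theorem wedgeCovectors_eq_zero_of_mem_ker (a : Fin k → V [⋀^Fin 1]→L[ℝ] ℝ) (v : Fin k → V)
    (j : Fin k) (hj : ∀ i, (a i fun _ => v j) = 0) : wedgeCovectors a v = 0 := by
  rw [wedgeCovectors_apply]
  exact Matrix.det_eq_zero_of_row_eq_zero j fun i => hj i

theorem wedgeCovectors_dual {a : Fin k → V [⋀^Fin 1]→L[ℝ] ℝ} {X : Fin k → V}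
    (hX : ∀ i j, (a i fun _ => X j) = if i = j then 1 else 0) : wedgeCovectors a X = 1 := by
  rw [wedgeCovectors_apply]
  convert Matrix.det_one (n := Fin k) (R := ℝ)
  ext j i
  simp [hX, Matrix.one_apply, eq_comm]

/-- Subtracting the components along the dual vectors leaves a vector in the common kernel. -/
theorem oneForm_sub_dual {a : Fin k → V [⋀^Fin 1]→L[ℝ] ℝ} {X : Fin k → V}
    (hX : ∀ i j, (a i fun _ => X j) = if i = j then 1 else 0) (v : V) (i : Fin k) :
    (a i fun _ => v - ∑ j, (a j fun _ => v) • X j) = 0 := by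
  rw [oneForm_sub, oneForm_sum]
  simp [oneForm_smul, hX]

/-- A covector vanishing on the common kernel of the `a i` is determined by its values on dual
vectors. -/
theorem oneForm_eq_sum_dual {a : Fin k → V [⋀^Fin 1]→L[ℝ] ℝ} {X : Fin k → V}
    (hX : ∀ i j, (a i fun _ => X j) = if i = j then 1 else 0) {b : V [⋀^Fin 1]→L[ℝ] ℝ}
    (hb : ∀ v, (∀ i, (a i fun _ => v) = 0) → (b fun _ => v) = 0) (v : V) :
    (b fun _ => v) = ∑ j, (a j fun _ => v) * b fun _ => X j := by
  have h := hb _ (oneForm_sub_dual hX v)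
  rw [oneForm_sub, oneForm_sum, sub_eq_zero] at h
  rw [h]
  exact Finset.sum_congr rfl fun j _ => oneForm_smul _ _ _

/-- The splitting of the vector space into the common kernel of the `a i` and the span of the dual
vectors. -/
def kerSplitting {a : Fin k → V [⋀^Fin 1]→L[ℝ] ℝ} {X : Fin k → V}
    (hX : ∀ i j, (a i fun _ => X j) = if i = j then 1 else 0) :
    V ≃ₗ[ℝ] (LinearMap.ker (LinearMap.pi fun i =>
      ((ContinuousAlternatingMap.ofSubsingleton ℝ V ℝ (0 : Fin 1)).symm (a i)).toLinearMap)) ×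
      (Fin k → ℝ) :=
  LinearEquiv.symm
  { toFun := fun p => p.1 + ∑ j, p.2 j • X j
    map_add' := fun p q => by simp [add_smul, Finset.sum_add_distrib]; abel
    map_smul' := fun c p => by simp [Finset.smul_sum, smul_smul]
    invFun := fun v => (⟨v - ∑ j, (a j fun _ => v) • X j, by
      rw [LinearMap.mem_ker]; funext i; exact oneForm_sub_dual hX v i⟩, fun i => a i fun _ => v)
    left_inv := fun ⟨⟨u, hu⟩, c⟩ => by
      have hu' : ∀ i, (a i fun _ => u) = 0 := fun i => congrFun (LinearMap.mem_ker.1 hu) i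
      have h : ∀ i, (a i fun _ => u + ∑ j, c j • X j) = c i := fun i => by
        rw [oneForm_add, oneForm_sum]
        simp [oneForm_smul, hX, hu']
      ext i
      · simp [h]
      · simp [h]
    right_inv := fun v => by simp }

/-- Wedging with `a₁ ∧ ⋯ ∧ a_k` kills precisely the forms that vanish on the common kernel of the
`a i`. -/
theorem wedgeAt_wedgeCovectors_eq_zero_iff {a : Fin k → V [⋀^Fin 1]→L[ℝ] ℝ} {X : Fin k → V}
    (hX : ∀ i j, (a i fun _ => X j) = if i = j then 1 else 0) (β : V [⋀^Fin r]→L[ℝ] ℝ) :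
    wedgeAt β (wedgeCovectors a) = 0 ↔
      ∀ v : Fin r → V, (∀ s i, (a i fun _ => v s) = 0) → β v = 0 := by
  have key : ∀ w : Fin (r + k) → V, wedgeAt β (wedgeCovectors a) w =
      ∑ q : Equiv.Perm.ModSumCongr (Fin r) (Fin k), LinearMap.mul' ℝ ℝ
        (AlternatingMap.domCoprod.summand β.toAlternatingMap (wedgeCovectors a).toAlternatingMap q
          fun i => w (finSumFinEquiv i)) := fun w => by
    change LinearMap.mul' ℝ ℝ ((β.toAlternatingMap.domCoprod
      (wedgeCovectors a).toAlternatingMap : MultilinearMap ℝ _ _) fun i => w (finSumFinEquiv i)) = _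
    rw [AlternatingMap.domCoprod_coe, sum_apply, map_sum]
  have summand : ∀ (σ : Equiv.Perm (Fin r ⊕ Fin k)) (w : Fin r ⊕ Fin k → V),
      LinearMap.mul' ℝ ℝ (AlternatingMap.domCoprod.summand β.toAlternatingMap
        (wedgeCovectors a).toAlternatingMap (Quotient.mk'' σ) w) =
      Equiv.Perm.sign σ • (β (fun s => w (σ (Sum.inl s))) *
        wedgeCovectors a fun t => w (σ (Sum.inr t))) := fun σ w => by
    rw [AlternatingMap.domCoprod.summand_mk'', smul_apply, Units.smul_def, Units.smul_def,
      map_zsmul]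
    rfl
  constructor
  · intro h v hv
    have h0 := key fun i => Sum.elim v X (finSumFinEquiv.symm i)
    simp only [h, Equiv.symm_apply_apply, AlternatingMap.zero_apply] at h0
    have h1 := h0.trans (Finset.sum_eq_single
      (Quotient.mk'' 1 : Equiv.Perm.ModSumCongr (Fin r) (Fin k)) ?_ ?_)
    · rw [show (fun i => Sum.elim v X i) = Sum.elim v X from rfl, summand] at h1
      simpa [wedgeCovectors_dual hX] using h1.symm
    · intro q _ hq
      induction q using Quotient.inductionOn' with
      | h σ =>
        rw [show (fun i => Sum.elim v X i) = Sum.elim v X from rfl, summand]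
        -- A shuffle other than the identity feeds a kernel vector to `a₁ ∧ ⋯ ∧ a_k`.
        by_cases hσ : ∃ t s, σ (Sum.inr t) = Sum.inl s
        · obtain ⟨t, s, hts⟩ := hσ
          rw [wedgeCovectors_eq_zero_of_mem_ker a _ t fun i => by simp [hts, hv], mul_zero,
            smul_zero]
        · refine absurd ?_ hq
          push Not at hσ
          refine Quotient.sound' (QuotientGroup.leftRel_apply.2 ?_)
          rw [mul_one, inv_mem_iff]
          refine Equiv.Perm.mem_sumCongrHom_range_of_perm_mapsTo_inl
            ((Equiv.Perm.perm_mapsTo_inl_iff_mapsTo_inr σ).2 ?_)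
          rintro _ ⟨t, rfl⟩
          rcases h : σ (Sum.inr t) with s | t'
          · exact absurd h (hσ t s)
          · exact ⟨t', rfl⟩
    · simp
  · intro h
    let e := kerSplitting hX
    let b := ((Module.Basis.ofVectorSpace ℝ _).prod (Pi.basisFun ℝ (Fin k))).map e.symm
    have hbl : ∀ c i, (a i fun _ => b (Sum.inl c)) = 0 := fun c i => by
      have : b (Sum.inl c) = ((Module.Basis.ofVectorSpace ℝ _ c :
          LinearMap.ker (LinearMap.pi fun i => ((ContinuousAlternatingMap.ofSubsingleton ℝ V ℝ
            (0 : Fin 1)).symm (a i)).toLinearMap)) : V) := by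
        simp [b, e, kerSplitting]
      rw [this]
      exact congrFun (LinearMap.mem_ker.1 (Subtype.prop (Module.Basis.ofVectorSpace ℝ _ c))) i
    refine Module.Basis.ext_alternating b fun v hv => ?_
    rw [key, AlternatingMap.zero_apply]
    refine Finset.sum_eq_zero fun q _ => ?_
    induction q using Quotient.inductionOn' with
    | h σ =>
      rw [summand]
      by_cases hσ : ∃ t c, v (finSumFinEquiv (σ (Sum.inr t))) = Sum.inl c
      · obtain ⟨t, c, htc⟩ := hσ
        rw [wedgeCovectors_eq_zero_of_mem_ker a _ t fun i => by rw [htc]; exact hbl c i, mul_zero,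
            smul_zero]
      · -- All dual vectors are used up by `a₁ ∧ ⋯ ∧ a_k`, so `β` only sees kernel vectors.
        push Not at hσ
        have : ∀ t, ∃ j, v (finSumFinEquiv (σ (Sum.inr t))) = Sum.inr j := fun t => by
          rcases h : v (finSumFinEquiv (σ (Sum.inr t))) with c | j
          · exact absurd h (hσ t c)
          · exact ⟨j, rfl⟩
        choose f hf using this
        have hinj : Function.Injective f := fun t t' htt => by
          have := (hf t).trans ((congrArg Sum.inr htt).trans (hf t').symm)
          simpa using hv this
        have hsurj := Finite.surjective_of_injective hinj
        rw [h _ fun s i => ?_, zero_mul, smul_zero]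
        rcases hs : v (finSumFinEquiv (σ (Sum.inl s))) with c | j
        · exact hbl c i
        · obtain ⟨t, rfl⟩ := hsurj j
          have := hv (hs.trans (hf t).symm)
          simp at this

/-- A `(k+1)`-form vanishes as soon as its contractions with the vectors in the common kernel of
`k` covectors do: any `k + 1` vectors have a nontrivial combination in that kernel. -/
theorem eq_zero_of_cons_mem_ker (a : Fin k → V [⋀^Fin 1]→L[ℝ] ℝ)
    (Ω : V [⋀^Fin (k + 1)]→L[ℝ] ℝ)
    (h : ∀ u, (∀ i, (a i fun _ => u) = 0) → ∀ w : Fin k → V,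
      Ω (Fin.cons u w : Fin (k + 1) → V) = 0) : Ω = 0 := by
  ext w
  have hdep : ¬ LinearIndependent ℝ fun (j : Fin (k + 1)) (i : Fin k) => a i fun _ => w j := by
    intro hli
    simpa using hli.fintype_card_le_finrank
  obtain ⟨c, hc, j₀, hj₀⟩ := Fintype.not_linearIndependent_iff.1 hdep
  have hu : ∀ i, (a i fun _ => ∑ j, c j • w j) = 0 := fun i => by
    rw [oneForm_sum]
    simpa [oneForm_smul] using congrFun hc i
  have h1 : Ω (Function.update w j₀ (∑ j, c j • w j)) = c j₀ * Ω w := by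
    change Ω.toAlternatingMap.toMultilinearMap _ = _
    rw [MultilinearMap.map_update_sum, Finset.sum_eq_single j₀]
    · rw [MultilinearMap.map_update_smul, Function.update_eq_self]; rfl
    · intro j _ hj
      rw [MultilinearMap.map_update_smul]
      exact (congrArg (c j • ·) (Ω.map_update_self w hj.symm)).trans (smul_zero _)
    · simp
  have h2 : Ω (Function.update w j₀ (∑ j, c j • w j)) = 0 := by
    have := AlternatingMap.map_insertNth Ω.toAlternatingMap j₀ (∑ j, c j • w j) (j₀.removeNth w)
    rw [Fin.insertNth_removeNth] at this
    refine this.trans ?_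
    exact (congrArg _ (h _ hu _)).trans (smul_zero _)
  rw [h1] at h2
  simpa using (mul_eq_zero.1 h2).resolve_left hj₀

/-- The derivative of the determinant in the direction `A * N`. -/
theorem sum_det_updateRow_mul (A N : Matrix (Fin k) (Fin k) ℝ) :
    ∑ j, (A.updateRow j ((A * N) j)).det = N.trace * A.det := by
  have h : ∀ j, (A.updateRow j ((A * N) j)).det = (A.adjugate.transpose * (A * N).transpose) j j :=
    fun j => by
      rw [← Matrix.cramer_transpose_apply, Matrix.cramer_eq_adjugate_mulVec,
        Matrix.adjugate_transpose]
      rfl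
  simp_rw [h]
  change Matrix.trace _ = _
  rw [← Matrix.transpose_mul, Matrix.trace_transpose, Matrix.mul_assoc, Matrix.trace_mul_comm,
    Matrix.mul_assoc, Matrix.adjugate_mul]
  simp [mul_comm]

/-- An endomorphism `B` that maps the common kernel of the `a i` into itself acts on
`a₁ ∧ ⋯ ∧ a_k` as a derivation by the trace of the induced map on the quotient. -/
theorem sum_wedgeCovectors_update {a : Fin k → V [⋀^Fin 1]→L[ℝ] ℝ} {X : Fin k → V}
    (hX : ∀ i j, (a i fun _ => X j) = if i = j then 1 else 0) (B : V →ₗ[ℝ] V)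
    (hB : ∀ v, (∀ i, (a i fun _ => v) = 0) → ∀ i, (a i fun _ => B v) = 0) (w : Fin k → V) :
    ∑ j, wedgeCovectors a (Function.update w j (B (w j))) =
      (∑ i, a i fun _ => B (X i)) * wedgeCovectors a w := by
  let A : Matrix (Fin k) (Fin k) ℝ := Matrix.of fun j i => a i fun _ => w j
  let N : Matrix (Fin k) (Fin k) ℝ := Matrix.of fun l i => a i fun _ => B (X l)
  rw [wedgeCovectors_apply a w]
  refine Eq.trans (Finset.sum_congr rfl fun j _ => ?_) (sum_det_updateRow_mul A N)
  rw [wedgeCovectors_apply]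
  congr 1
  ext l i
  rcases eq_or_ne l j with rfl | hl
  · have h := hB _ (oneForm_sub_dual hX (w l)) i
    rw [map_sub, map_sum, oneForm_sub, oneForm_sum, sub_eq_zero] at h
    simp [A, N, Matrix.mul_apply, h, oneForm_smul]
  · simp [A, hl]

/-- Covectors vanishing on the common kernel of the `a i` have a wedge product proportional to
`a₁ ∧ ⋯ ∧ a_k`. -/
theorem wedgeCovectors_eq_mul {a b : Fin k → V [⋀^Fin 1]→L[ℝ] ℝ} {X : Fin k → V}
    (hX : ∀ i j, (a i fun _ => X j) = if i = j then 1 else 0)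
    (hb : ∀ v, (∀ i, (a i fun _ => v) = 0) → ∀ i, (b i fun _ => v) = 0) :
    wedgeCovectors b = wedgeCovectors b X • wedgeCovectors a := by
  ext w
  rw [ContinuousAlternatingMap.smul_apply, smul_eq_mul, mul_comm]
  simp only [wedgeCovectors_apply]
  rw [← Matrix.det_mul]
  congr 1
  ext j i
  simp only [Matrix.mul_apply, Matrix.of_apply]
  exact oneForm_eq_sum_dual hX (fun v hv => hb v hv i) (w j)

theorem wedgeCovectors_ne_zero {a b : Fin k → V [⋀^Fin 1]→L[ℝ] ℝ} {X : Fin k → V}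
    (hX : ∀ i j, (a i fun _ => X j) = if i = j then 1 else 0)
    (hb : ∀ v, (∀ i, (b i fun _ => v) = 0) → ∀ i, (a i fun _ => v) = 0) :
    wedgeCovectors b X ≠ 0 := by
  rw [wedgeCovectors_apply]
  intro h0
  obtain ⟨c, hc, hc0⟩ := Matrix.exists_vecMul_eq_zero_iff.2 h0
  refine hc (funext fun i => ?_)
  have h := hb (∑ j, c j • X j) (fun i => by
    rw [oneForm_sum]
    simpa [oneForm_smul, Matrix.vecMul, dotProduct] using congrFun hc0 i) i
  rw [oneForm_sum] at h
  simpa [oneForm_smul, hX] using h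

theorem exists_dual_of_linearIndependent {a : Fin k → V [⋀^Fin 1]→L[ℝ] ℝ}
    (ha : LinearIndependent ℝ a) :
    ∃ X : Fin k → V, ∀ i j, (a i fun _ => X j) = if i = j then 1 else 0 := by
  let L : V →ₗ[ℝ] (Fin k → ℝ) := LinearMap.pi fun i =>
    ((ContinuousAlternatingMap.ofSubsingleton ℝ V ℝ (0 : Fin 1)).symm (a i)).toLinearMap
  have hL : LinearMap.range L = ⊤ := by
    by_contra hne
    obtain ⟨f, hf0, hf⟩ := Submodule.exists_le_ker_of_lt_top _ (lt_top_iff_ne_top.2 hne)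
    refine hf0 (LinearMap.pi_ext' fun i => LinearMap.ext_ring ?_)
    have hi : (Pi.single i 1 : Fin k → ℝ) = fun j => if i = j then 1 else 0 := by
      ext j
      simp [Pi.single_apply, eq_comm]
    change f (Pi.single i 1) = 0
    rw [hi]
    refine Fintype.linearIndependent_iff.1 ha (fun i => f fun j => if i = j then 1 else 0) ?_ i
    ext v
    have h := LinearMap.mem_ker.1 (hf (LinearMap.mem_range_self L (v 0)))
    rw [LinearMap.pi_apply_eq_sum_univ f] at h
    have hv : v = fun _ => v 0 := funext fun i => by rw [Subsingleton.elim i 0]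
    rw [hv]
    simpa [mul_comm, L] using h
  choose X hX using fun j => LinearMap.range_eq_top.1 hL (Pi.single j 1)
  exact ⟨X, fun i j => (congrFun (hX j) i).trans (by simp [Pi.single_apply])⟩

end Pointwise

/-! ### Exterior derivatives on a normed space -/

section Local

variable {E : Type*} [NormedAddCommGroup E] [NormedSpace ℝ E] {k n : ℕ}

/-- Antisymmetrization with the first argument singled out: moving the argument `u` back to the
place of the removed one absorbs the signs. -/
theorem alternatizeUncurryFin_cons (T : E →L[ℝ] E [⋀^Fin k]→L[ℝ] ℝ) (u : E) (w : Fin k → E) :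
    ContinuousAlternatingMap.alternatizeUncurryFin T (Fin.cons u w : Fin (k + 1) → E) =
      T u w - ∑ j, T (w j) (Function.update w j u) := by
  rw [ContinuousAlternatingMap.alternatizeUncurryFin_apply, Fin.sum_univ_succ, sub_eq_add_neg,
    ← Finset.sum_neg_distrib]
  congr 1
  · simp
  · refine Finset.sum_congr rfl fun j _ => ?_
    cases k with
    | zero => exact j.elim0
    | succ n =>
      have h1 : j.succ.removeNth (Fin.cons u w : Fin (n + 2) → E) =
          (Fin.cons u (j.removeNth w) : Fin (n + 1) → E) := by
        funext l
        refine Fin.cases ?_ (fun l => ?_) l <;> simp [Fin.removeNth]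
      have h2 := AlternatingMap.map_insertNth (T (w j)).toAlternatingMap j u (j.removeNth w)
      rw [Fin.insertNth_removeNth] at h2
      have h3 : T (w j) (Function.update w j u) =
        (-1) ^ (j : ℕ) • T (w j) (Fin.cons u (j.removeNth w) : Fin (n + 1) → E) := h2
      rw [h1, Fin.cons_succ, h3, Fin.val_succ, pow_succ]
      simp

theorem curryLeft_apply_const (η : E [⋀^Fin 2]→L[ℝ] ℝ) (u v : E) :
    (η.curryLeft u fun _ => v) = η ![u, v] := by
  rw [ContinuousAlternatingMap.curryLeft_apply_apply]
  congr 1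
  funext l
  fin_cases l <;> rfl

theorem twoForm_swap (η : E [⋀^Fin 2]→L[ℝ] ℝ) (u v : E) : η ![u, v] = -η ![v, u] := by
  refine Eq.trans (congrArg η ?_) (η.map_swap ![v, u] (i := 0) (j := 1) (by simp))
  funext l
  fin_cases l <;> rfl

theorem extDeriv_oneForm (θ : E → E [⋀^Fin 1]→L[ℝ] ℝ) (y : E) (w : Fin 2 → E) :
    extDeriv θ y w = fderiv ℝ θ y (w 0) (fun _ => w 1) - fderiv ℝ θ y (w 1) fun _ => w 0 := by
  rw [extDeriv, ContinuousAlternatingMap.alternatizeUncurryFin_apply, Fin.sum_univ_two]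
  have h0 : (0 : Fin 2).removeNth w = fun _ => w 1 := by
    funext l; rw [Subsingleton.elim l 0]; rfl
  have h1 : (1 : Fin 2).removeNth w = fun _ => w 0 := by
    funext l; rw [Subsingleton.elim l 0]; rfl
  rw [h0, h1]
  simp [sub_eq_add_neg]

theorem extDeriv_twoForm (η : E → E [⋀^Fin 2]→L[ℝ] ℝ) (y u v w : E) :
    extDeriv η y ![u, v, w] =
      fderiv ℝ η y u ![v, w] - fderiv ℝ η y v ![u, w] + fderiv ℝ η y w ![u, v] := by
  rw [extDeriv, ContinuousAlternatingMap.alternatizeUncurryFin_apply, Fin.sum_univ_three]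
  have h0 : (0 : Fin 3).removeNth ![u, v, w] = ![v, w] := by
    funext l; fin_cases l <;> rfl
  have h1 : (1 : Fin 3).removeNth ![u, v, w] = ![u, w] := by
    funext l; fin_cases l <;> rfl
  have h2 : (2 : Fin 3).removeNth ![u, v, w] = ![u, v] := by
    funext l; fin_cases l <;> rfl
  rw [h0, h1, h2]
  simp [sub_eq_add_neg]

/-- Leibniz rule for a 1-form applied to a vector field. -/
theorem hasFDerivAt_oneForm_apply {θ : E → E [⋀^Fin 1]→L[ℝ] ℝ} {p : E → E} {y : E}
    (hθ : DifferentiableAt ℝ θ y) (hp : DifferentiableAt ℝ p y) :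
    ∃ L : E →L[ℝ] ℝ, HasFDerivAt (fun z => θ z fun _ => p z) L y ∧
      ∀ z, L z = (fderiv ℝ θ y z fun _ => p y) + θ y fun _ => fderiv ℝ p y z := by
  have h := ((ContinuousAlternatingMap.toContinuousMultilinearMapCLM (𝕜 := ℝ) (E := E) (F := ℝ)
    (ι := Fin 1) ℝ).hasFDerivAt.comp y hθ.hasFDerivAt).continuousMultilinearMap_apply
      (g := fun _ => p) (g' := fun _ => fderiv ℝ p y) fun _ => hp.hasFDerivAt
  refine ⟨_, h, fun z => ?_⟩
  have hu : Function.update (fun _ : Fin 1 => p y) 0 (fderiv ℝ p y z) =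
      fun _ => fderiv ℝ p y z := by
    funext l; rw [Subsingleton.elim l 0]; simp
  simp [ContinuousMultilinearMap.toContinuousLinearMap, hu]

/-- Leibniz rule for a 2-form applied to two vector fields. -/
theorem hasFDerivAt_twoForm_apply {η : E → E [⋀^Fin 2]→L[ℝ] ℝ} {p q : E → E} {y : E}
    (hη : DifferentiableAt ℝ η y) (hp : DifferentiableAt ℝ p y) (hq : DifferentiableAt ℝ q y) :
    ∃ L : E →L[ℝ] ℝ, HasFDerivAt (fun z => η z ![p z, q z]) L y ∧
      ∀ z, L z = fderiv ℝ η y z ![p y, q y] + η y ![fderiv ℝ p y z, q y] +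
        η y ![p y, fderiv ℝ q y z] := by
  have h := ((ContinuousAlternatingMap.toContinuousMultilinearMapCLM (𝕜 := ℝ) (E := E) (F := ℝ)
    (ι := Fin 2) ℝ).hasFDerivAt.comp y hη.hasFDerivAt).continuousMultilinearMap_apply
      (g := ![p, q]) (g' := ![fderiv ℝ p y, fderiv ℝ q y]) fun i => by
        fin_cases i
        · exact hp.hasFDerivAt
        · exact hq.hasFDerivAt
  have e : ∀ z, (fun i => (![p, q] : Fin 2 → E → E) i z) = ![p z, q z] := fun z => by
    funext l; fin_cases l <;> rfl
  simp only [e] at h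
  refine ⟨_, h, fun z => ?_⟩
  have hu0 : Function.update ![p y, q y] 0 (fderiv ℝ p y z) = ![fderiv ℝ p y z, q y] := by
    funext l; fin_cases l <;> rfl
  have hu1 : Function.update ![p y, q y] 1 (fderiv ℝ q y z) = ![p y, fderiv ℝ q y z] := by
    funext l; fin_cases l <;> rfl
  simp [ContinuousMultilinearMap.toContinuousLinearMap, hu0, hu1, add_assoc]

/-- The differential of `μ = a₁ ∧ ⋯ ∧ a_k` in the direction `z` is the derivation induced by the
endomorphism `v ↦ ∑ (D_z a_i)(v) X_i`. -/
theorem fderiv_wedgeCovectors_apply {a : Fin k → E → E [⋀^Fin 1]→L[ℝ] ℝ} {y : E} {X : Fin k → E}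
    (ha : ∀ i, DifferentiableAt ℝ (a i) y)
    (hμ : DifferentiableAt ℝ (fun z => wedgeCovectors fun i => a i z) y)
    (hX : ∀ i j, (a i y fun _ => X j) = if i = j then 1 else 0) (z : E) (w : Fin k → E) :
    fderiv ℝ (fun z => wedgeCovectors fun i => a i z) y z w =
      ∑ j, wedgeCovectors (fun i => a i y)
        (Function.update w j (∑ i, (fderiv ℝ (a i) y z fun _ => w j) • X i)) := by
  let D : (Fin k → ℝ) [⋀^Fin k]→L[ℝ] ℝ := wedgeCovectors fun i =>
    ContinuousAlternatingMap.ofSubsingleton ℝ _ ℝ (0 : Fin 1) (ContinuousLinearMap.proj i)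
  have h1 := (D.toContinuousMultilinearMap.hasFDerivAt fun j i => a i y fun _ => w j).comp y
    (f := fun z j i => a i z fun _ => w j)
    (hasFDerivAt_pi.2 fun j => hasFDerivAt_pi.2 fun i =>
      (ha i).hasFDerivAt.continuousAlternatingMap_apply_const fun _ => w j)
  have h2 := hμ.hasFDerivAt.continuousAlternatingMap_apply_const w
  have h3 := DFunLike.congr_fun (h2.unique h1) z
  refine h3.trans ?_
  simp only [ContinuousLinearMap.comp_apply, ContinuousMultilinearMap.linearDeriv_apply]
  refine Finset.sum_congr rfl fun j _ => ?_
  change wedgeCovectors _ _ = _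
  rw [wedgeCovectors_apply, wedgeCovectors_apply]
  congr 1
  ext l i
  rcases eq_or_ne l j with rfl | hl
  · simp [oneForm_sum, oneForm_smul, hX]
  · simp [hl]

/-- If the `da_i` vanish on the common kernel of the `a_i`, then `d(g μ)`, for
`μ = a₁ ∧ ⋯ ∧ a_k` and a function `g`, is `(dg + g δ) ∧ μ` with `δ = ∑ da_i(·, X_i)`. -/
theorem extDeriv_smul_wedgeCovectors_cons {a : Fin k → E → E [⋀^Fin 1]→L[ℝ] ℝ} {y : E}
    {X : Fin k → E} {g : E → ℝ} (ha : ∀ i, DifferentiableAt ℝ (a i) y)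
    (hμ : DifferentiableAt ℝ (fun z => wedgeCovectors fun i => a i z) y)
    (hg : DifferentiableAt ℝ g y)
    (hX : ∀ i j, (a i y fun _ => X j) = if i = j then 1 else 0)
    (hint : ∀ (i : Fin k) (v : Fin 2 → E), (∀ s j, (a j y fun _ => v s) = 0) →
      extDeriv (a i) y v = 0)
    {u : E} (hu : ∀ i, (a i y fun _ => u) = 0) (w : Fin k → E) :
    extDeriv (fun z => g z • wedgeCovectors fun i => a i z) y (Fin.cons u w : Fin (k + 1) → E) =
      (fderiv ℝ g y u + g y * ∑ i, extDeriv (a i) y ![u, X i]) *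
        wedgeCovectors (fun i => a i y) w := by
  let μ : E → E [⋀^Fin k]→L[ℝ] ℝ := fun z => wedgeCovectors fun i => a i z
  have hker : ∀ (w : Fin k → E) (j : Fin k), w j = u → μ y w = 0 := fun w j hj =>
    wedgeCovectors_eq_zero_of_mem_ker _ _ j fun i => by rw [hj]; exact hu i
  have h1 : fderiv ℝ (fun z => g z • μ z) y = g y • fderiv ℝ μ y + (fderiv ℝ g y).smulRight (μ y) :=
    (hg.hasFDerivAt.smul hμ.hasFDerivAt).fderiv
  -- The endomorphism `v ↦ ∑ da_i(u, v) X_i`, whose trace modulo the kernel is `δ(u)`.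
  let B : E →ₗ[ℝ] E := ∑ i, LinearMap.smulRight
    ((ContinuousAlternatingMap.ofSubsingleton ℝ E ℝ (0 : Fin 1)).symm
      ((extDeriv (a i) y).curryLeft u)).toLinearMap (X i)
  have hB : ∀ v, B v = ∑ i, extDeriv (a i) y ![u, v] • X i := fun v => by
    simp only [B, LinearMap.sum_apply, LinearMap.smulRight_apply]
    exact Finset.sum_congr rfl fun i _ => congrArg (· • X i) (curryLeft_apply_const _ u v)
  have haB : ∀ i v, (a i y fun _ => B v) = extDeriv (a i) y ![u, v] := fun i v => by
    rw [hB, oneForm_sum]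
    simp [oneForm_smul, hX]
  have htr := sum_wedgeCovectors_update hX B (fun v hv i => by
    rw [haB]
    refine hint i _ fun s j => ?_
    fin_cases s
    · exact hu j
    · exact hv j) w
  simp only [haB] at htr
  -- The remaining terms of `dμ(u, w)`: a determinant with `u` in one of its rows is zero, so only
  -- the derivation term acting on `u` itself survives.
  have hcross : ∀ j, fderiv ℝ μ y (w j) (Function.update w j u) =
      μ y (Function.update w j (∑ i, (fderiv ℝ (a i) y (w j) fun _ => u) • X i)) := fun j => by
    rw [fderiv_wedgeCovectors_apply ha hμ hX, Finset.sum_eq_single j]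
    · simp [μ]
    · intro l _ hl
      exact hker _ j (by simp [hl.symm])
    · simp
  have hμd : ContinuousAlternatingMap.alternatizeUncurryFin (fderiv ℝ μ y)
      (Fin.cons u w : Fin (k + 1) → E) = (∑ i, extDeriv (a i) y ![u, X i]) * μ y w := by
    rw [alternatizeUncurryFin_cons, fderiv_wedgeCovectors_apply ha hμ hX, ← htr,
      ← Finset.sum_sub_distrib]
    refine Finset.sum_congr rfl fun j _ => ?_
    rw [hcross]
    have := (μ y).map_update_sub w j (∑ i, (fderiv ℝ (a i) y u fun _ => w j) • X i)
      (∑ i, (fderiv ℝ (a i) y (w j) fun _ => u) • X i)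
    refine this.symm.trans ?_
    rw [hB, ← Finset.sum_sub_distrib]
    congr 2
    refine Finset.sum_congr rfl fun i _ => ?_
    rw [← sub_smul, extDeriv_oneForm]
    rfl
  have hgd : ContinuousAlternatingMap.alternatizeUncurryFin ((fderiv ℝ g y).smulRight (μ y))
      (Fin.cons u w : Fin (k + 1) → E) = fderiv ℝ g y u * μ y w := by
    rw [alternatizeUncurryFin_cons, Finset.sum_eq_zero, sub_zero]
    · rfl
    · intro j _
      exact (congrArg (fderiv ℝ g y (w j) • ·) (hker _ j (by simp))).trans (smul_zero _)
  rw [extDeriv]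
  change ContinuousAlternatingMap.alternatizeUncurryFin (fderiv ℝ (fun z => g z • μ z) y) _ =
    _ * μ y w
  rw [h1, ContinuousAlternatingMap.alternatizeUncurryFin_add,
    ContinuousAlternatingMap.alternatizeUncurryFin_smul, 
    ContinuousAlternatingMap.add_apply, ContinuousAlternatingMap.smul_apply, hμd, hgd,
    smul_eq_mul]
  ring

/-- Rescaling does not affect the vanishing of the exterior derivative on the kernel. -/
theorem extDeriv_smul_oneForm_eq_zero {θ : E → E [⋀^Fin 1]→L[ℝ] ℝ} {g : E → ℝ} {y : E}
    (hθ : DifferentiableAt ℝ θ y) (hg : DifferentiableAt ℝ g y) {v : Fin 2 → E}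
    (hv : ∀ s, (θ y fun _ => v s) = 0) (hd : extDeriv θ y v = 0) :
    extDeriv (fun z => g z • θ z) y v = 0 := by
  have h1 : fderiv ℝ (fun z => g z • θ z) y = g y • fderiv ℝ θ y + (fderiv ℝ g y).smulRight (θ y) :=
    (hg.hasFDerivAt.smul hθ.hasFDerivAt).fderiv
  rw [extDeriv_oneForm] at hd ⊢
  rw [h1]
  have h2 := congrArg (g y * ·) hd
  simp only [mul_sub, mul_zero] at h2
  simpa [hv] using h2

/-- If the `da_i` vanish on the common kernel of the `a_i`, then so does the exterior derivative of
`δ = -∑ i_{X_i} da_i`. In a frame adapted to the kernel this is the vanishing of the trace of a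
commutator. -/
theorem extDeriv_delta_eq_zero {a : Fin k → E → E [⋀^Fin 1]→L[ℝ] ℝ} {y : E} {X : Fin k → E → E}
    (ha : ∀ i, ContDiffAt ℝ ∞ (a i) y) (hXd : ∀ i, DifferentiableAt ℝ (X i) y)
    (hX : ∀ᶠ z in 𝓝 y, ∀ i j, (a i z fun _ => X j z) = if i = j then 1 else 0)
    (hint : ∀ᶠ z in 𝓝 y, ∀ (i : Fin k) (v : Fin 2 → E), (∀ s j, (a j z fun _ => v s) = 0) →
      extDeriv (a i) z v = 0)
    {w : Fin 2 → E} (hw : ∀ s j, (a j y fun _ => w s) = 0) :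
    extDeriv (fun z => -∑ i, (extDeriv (a i) z).curryLeft (X i z)) y w = 0 := by
  have had : ∀ i, DifferentiableAt ℝ (a i) y := fun i => (ha i).differentiableAt (by simp)
  have hdC : ∀ i, ContDiffAt ℝ ∞ (extDeriv (a i)) y := fun i => by
    have h := (ContinuousAlternatingMap.alternatizeUncurryFinCLM ℝ E ℝ
      (n := 1)).contDiff.contDiffAt.comp y ((ha i).fderiv_right (m := ∞) (by simp))
    exact h
  have hdd : ∀ i, DifferentiableAt ℝ (extDeriv (a i)) y := fun i =>
    (hdC i).differentiableAt (by simp)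
  -- `A i z v = (D_z a_i)(v)`, `o i = da_i`, `W i z = D_z(da_i)` and `D i z = D_z X_i`, all at `y`.
  let A : Fin k → E → E → ℝ := fun i z v => fderiv ℝ (a i) y z fun _ => v
  let o : Fin k → E → E → ℝ := fun i u v => extDeriv (a i) y ![u, v]
  let W : Fin k → E → E → E → ℝ := fun i z u v => fderiv ℝ (extDeriv (a i)) y z ![u, v]
  let D : Fin k → E → E := fun i => fderiv ℝ (X i) y
  have hX0 := hX.self_of_nhds
  have hadd : ∀ (η : E [⋀^Fin 2]→L[ℝ] ℝ), ∃ T : E →ₗ[ℝ] E →ₗ[ℝ] ℝ, ∀ u v, η ![u, v] = T u v :=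
    fun η => ⟨LinearMap.mk₂ ℝ (fun u v => η ![u, v])
      (fun u u' v => by
        simp only [← curryLeft_apply_const, map_add]; rfl)
      (fun c u v => by
        simp only [← curryLeft_apply_const, map_smul]; rfl)
      (fun u v v' => by
        simp only [← curryLeft_apply_const, oneForm_add])
      (fun c u v => by
        simp only [← curryLeft_apply_const, oneForm_smul]; rfl), fun u v => rfl⟩
  have ho : ∀ i u v, o i u v = A i u v - A i v u := fun i u v => extDeriv_oneForm (a i) y _
  -- `dda_i = 0`.
  have hclosed : ∀ i u v w, W i u v w - W i v u w + W i w u v = 0 := fun i u v w => by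
    have h := extDeriv_extDeriv_apply (ha i) (by
      simp only [minSmoothness_of_isRCLikeNormedField]
      exact WithTop.coe_le_coe.2 (le_top : (2 : ℕ∞) ≤ ⊤))
    have h' := extDeriv_twoForm (extDeriv (a i)) y u v w
    rw [h] at h'
    exact h'.symm
  -- The differentiated relation `a_i(X_j) = δ_ij`.
  have hdual : ∀ i j z, A i z (X j y) + (a i y fun _ => D j z) = 0 := fun i j z => by
    obtain ⟨L, hL, hLz⟩ := hasFDerivAt_oneForm_apply (had i) (hXd j)
    have hc : HasFDerivAt (fun z => a i z fun _ => X j z) (0 : E →L[ℝ] ℝ) y :=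
      (hasFDerivAt_const (if i = j then (1 : ℝ) else 0) y).congr_of_eventuallyEq
        (hX.mono fun z hz => hz i j)
    rw [← hLz z, hL.unique hc]
    rfl
  -- The projections to the kernel, differentiated on kernel vectors.
  have hproj : ∀ u, (∀ j, (a j y fun _ => u) = 0) → ∃ p : E → E, DifferentiableAt ℝ p y ∧
      p y = u ∧ (∀ z, fderiv ℝ p y z = -∑ j, A j z u • X j y) ∧
      ∀ᶠ z in 𝓝 y, ∀ j, (a j z fun _ => p z) = 0 := fun u hu => by
    have hd : HasFDerivAt (fun z => u - ∑ j, (a j z fun _ => u) • X j z)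
        (-∑ j, ((a j y fun _ => u) • fderiv ℝ (X j) y +
          ((fderiv ℝ (a j) y).flipAlternating fun _ => u).smulRight (X j y))) y := by
      refine HasFDerivAt.const_sub ?_ u
      exact HasFDerivAt.fun_sum fun j _ =>
        ((had j).hasFDerivAt.continuousAlternatingMap_apply_const fun _ => u).smul
          (hXd j).hasFDerivAt
    refine ⟨_, hd.differentiableAt, by simp [hu], fun z => ?_, hX.mono fun z hz j => ?_⟩
    · rw [hd.fderiv]
      simp [hu, A]
    · exact oneForm_sub_dual hz u j
  -- The differentiated relation `da_i(p, q) = 0` for `p`, `q` in the kernel.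
  have hW : ∀ i z u v, (∀ j, (a j y fun _ => u) = 0) → (∀ j, (a j y fun _ => v) = 0) →
      W i z u v = ∑ j, (A j z u * o i (X j y) v + A j z v * o i u (X j y)) :=
    fun i z u v hu hv => by
    obtain ⟨p, hp, hpy, hpd, hpk⟩ := hproj u hu
    obtain ⟨q, hq, hqy, hqd, hqk⟩ := hproj v hv
    obtain ⟨L, hL, hLz⟩ := hasFDerivAt_twoForm_apply (hdd i) hp hq
    have hc : HasFDerivAt (fun z => extDeriv (a i) z ![p z, q z]) (0 : E →L[ℝ] ℝ) y := by
      refine (hasFDerivAt_const (0 : ℝ) y).congr_of_eventuallyEq ?_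
      filter_upwards [hpk, hqk, hint] with z hpz hqz hz
      refine hz i _ fun s j => ?_
      fin_cases s
      · exact hpz j
      · exact hqz j
    have h := hLz z
    rw [hL.unique hc, hpd, hqd, hpy, hqy] at h
    obtain ⟨T, hT⟩ := hadd (extDeriv (a i) y)
    simp only [hT, map_neg, map_sum, map_smul, LinearMap.neg_apply, LinearMap.sum_apply,
      LinearMap.smul_apply, smul_eq_mul, zero_apply] at h
    simp only [W, o, hT, Finset.sum_add_distrib]
    linarith
  have hexp : ∀ i v w, (∀ j, (a j y fun _ => v) = 0) →
      o i v w = ∑ j, (a j y fun _ => w) * o i v (X j y) := fun i v w hv => by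
    have h := oneForm_eq_sum_dual hX0 (b := (extDeriv (a i) y).curryLeft v) (fun u hu => by
      rw [curryLeft_apply_const]
      refine hint.self_of_nhds i _ fun s j => ?_
      fin_cases s
      · exact hv j
      · exact hu j) w
    simpa only [curryLeft_apply_const] using h
  have hδ : ∀ z v, fderiv ℝ (fun z => -∑ i, (extDeriv (a i) z).curryLeft (X i z)) y z (fun _ => v) =
      -∑ i, (W i z (X i y) v + o i (D i z) v) := fun z v => by
    have hL2 : ∀ i, ∃ L : E →L[ℝ] ℝ, HasFDerivAt (fun z => extDeriv (a i) z ![X i z, v]) L y ∧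
        ∀ z, L z = W i z (X i y) v + o i (D i z) v := fun i => by
      obtain ⟨L, hL, hLz⟩ := hasFDerivAt_twoForm_apply (hdd i) (hXd i)
        (differentiableAt_const (c := v))
      refine ⟨L, hL, fun z => ?_⟩
      obtain ⟨T, hT⟩ := hadd (extDeriv (a i) y)
      simp [hLz, W, o, D, hT]
    choose L hL hLz using hL2
    have hcurry : ∀ i, DifferentiableAt ℝ (fun z => (extDeriv (a i) z).curryLeft (X i z)) y :=
      fun i => by
      have hL : ContDiff ℝ ∞ (ContinuousAlternatingMap.curryLeft :
          (E [⋀^Fin 2]→L[ℝ] ℝ) → (E →L[ℝ] (E [⋀^Fin 1]→L[ℝ] ℝ))) :=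
        LinearIsometry.contDiff (𝕜 := ℝ) (E := E [⋀^Fin 2]→L[ℝ] ℝ)
          (F := E →L[ℝ] (E [⋀^Fin 1]→L[ℝ] ℝ)) ContinuousAlternatingMap.curryLeftLI
      exact ((hL.contDiffAt.comp y (hdC i)).differentiableAt (by simp)).clm_apply (hXd i)
    have hdiff : DifferentiableAt ℝ (fun z => -∑ i, (extDeriv (a i) z).curryLeft (X i z)) y :=
      (DifferentiableAt.fun_sum fun i _ => hcurry i).neg
    have h1 := hdiff.hasFDerivAt.continuousAlternatingMap_apply_const fun _ => v
    have h2 : HasFDerivAt (fun z => (-∑ i, (extDeriv (a i) z).curryLeft (X i z)) fun _ => v)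
        (-∑ i, L i) y := by
      refine (HasFDerivAt.fun_sum fun i _ => hL i).neg.congr_of_eventuallyEq
        (.of_forall fun z => ?_)
      simp only [ContinuousAlternatingMap.neg_apply, ContinuousAlternatingMap.sum_apply,
        curryLeft_apply_const]
      rfl
    have h3 := DFunLike.congr_fun (h1.unique h2) z
    refine Eq.trans h3 ?_
    simp [hLz]
  rw [extDeriv_oneForm, hδ, hδ]
  set u := w 0
  set v := w 1
  have hu : ∀ j, (a j y fun _ => u) = 0 := hw 0
  have hv : ∀ j, (a j y fun _ => v) = 0 := hw 1
  -- The summands are antisymmetric in `i` and `j`, so the sum over both vanishes.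
  have hterm : ∀ i, (W i v (X i y) u + o i (D i v) u) - (W i u (X i y) v + o i (D i u) v) =
      ∑ j, (o i u (X j y) * o j v (X i y) - o i v (X j y) * o j u (X i y)) := fun i => by
    have h1 := hclosed i u (X i y) v
    have h2 : W i v u (X i y) = -W i v (X i y) u := twoForm_swap _ _ _
    have h3 := hW i (X i y) u v hu hv
    have h4 : o i (D i u) v = -o i v (D i u) := twoForm_swap _ _ _
    have h5 : o i (D i v) u = -o i u (D i v) := twoForm_swap _ _ _
    have h6 := hexp i v (D i u) hv
    have h7 := hexp i u (D i v) hu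
    have h8 : (W i v (X i y) u + o i (D i v) u) - (W i u (X i y) v + o i (D i u) v) =
        -W i (X i y) u v - o i u (D i v) + o i v (D i u) := by linarith
    rw [h8, h3, h6, h7, ← Finset.sum_neg_distrib, ← Finset.sum_sub_distrib,
      ← Finset.sum_add_distrib]
    refine Finset.sum_congr rfl fun j _ => ?_
    have h9 := hdual j i u
    have h10 := hdual j i v
    have h11 : o i (X j y) v = -o i v (X j y) := twoForm_swap _ _ _
    rw [h11, ho j v, ho j u, eq_neg_of_add_eq_zero_right h9, eq_neg_of_add_eq_zero_right h10]
    ring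
  have : -∑ i, (W i u (X i y) v + o i (D i u) v) - -∑ i, (W i v (X i y) u + o i (D i v) u) =
      ∑ i, ((W i v (X i y) u + o i (D i v) u) - (W i u (X i y) v + o i (D i u) v)) := by
    rw [Finset.sum_sub_distrib]; ring
  rw [this, Finset.sum_congr rfl fun i _ => hterm i]
  simp only [Finset.sum_sub_distrib]
  rw [sub_eq_zero, Finset.sum_comm]
  exact Finset.sum_congr rfl fun j _ => Finset.sum_congr rfl fun i _ => mul_comm _ _

end Local

/-! ### Forms and vector fields in charts -/

theorem contDiffOn_det {E : Type*} [NormedAddCommGroup E] [NormedSpace ℝ E] {k : ℕ}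
    {A : E → Matrix (Fin k) (Fin k) ℝ} {s : Set E}
    (hA : ∀ i j, ContDiffOn ℝ ∞ (fun y => A y i j) s) : ContDiffOn ℝ ∞ (fun y => (A y).det) s := by
  simp only [Matrix.det_apply, Units.smul_def, zsmul_eq_mul]
  exact ContDiffOn.sum fun σ _ => contDiffOn_const.mul (contDiffOn_prod fun i _ => hA _ _)

section Transfer

variable {E : Type*} [NormedAddCommGroup E] [NormedSpace ℝ E]
  {M : Type*} [TopologicalSpace M] [ChartedSpace E M] {k n : ℕ}

theorem inChart_apply (η : RawForm E M n) (c : M) (y : E) (v : Fin n → E) :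
    η.inChart c y v = η ((extChartAt 𝓘(ℝ, E) c).symm y) fun s => chartSymmD c y (v s) := rfl

theorem Form.differentiableAt_inChart (η : Form E M n) {c : M} {y : E}
    (hy : y ∈ (extChartAt 𝓘(ℝ, E) c).target) : DifferentiableAt ℝ (η.1.inChart c) y :=
  ((η.2 c).contDiffAt ((isOpen_extChartAt_target c).mem_nhds hy)).differentiableAt (by simp)

theorem contDiffOn_oneForm_apply {θ : E → E [⋀^Fin 1]→L[ℝ] ℝ} {p : E → E} {s : Set E}
    (hθ : ContDiffOn ℝ ∞ θ s) (hp : ContDiffOn ℝ ∞ p s) :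
    ContDiffOn ℝ ∞ (fun y => θ y fun _ => p y) s := by
  let S : (E [⋀^Fin 1]→L[ℝ] ℝ) →L[ℝ] (E →L[ℝ] ℝ) :=
    (ContinuousAlternatingMap.ofSubsingletonLIE (𝕜 := ℝ) (E := E) (F := ℝ)
      (0 : Fin 1)).symm.toContinuousLinearEquiv
  have h1 : ContDiffOn ℝ ∞ (fun y => S (θ y)) s := S.contDiff.comp_contDiffOn hθ
  exact h1.clm_apply hp

/-- To prove something at every point of a manifold it suffices to prove it at the points
parametrized by the inverse charts. -/
theorem forall_of_chart {P : M → Prop}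
    (h : ∀ c : M, ∀ y ∈ (extChartAt 𝓘(ℝ, E) c).target, P ((extChartAt 𝓘(ℝ, E) c).symm y))
    (x : M) : P x := by
  have := h x _ (mem_extChartAt_target x)
  rwa [extChartAt_to_inv] at this

variable [IsManifold 𝓘(ℝ, E) ∞ M]

theorem chartSymmD_surjective (c : M) {y : E} (hy : y ∈ (extChartAt 𝓘(ℝ, E) c).target) :
    Function.Surjective (chartSymmD c y) := fun v => by
  obtain ⟨A, hA⟩ := isInvertible_mfderiv_extChartAt_symm c hy
  refine ⟨A.symm v, ?_⟩
  change (mfderiv 𝓘(ℝ, E) 𝓘(ℝ, E) (extChartAt 𝓘(ℝ, E) c).symm y) (A.symm v) = v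
  rw [← hA]
  exact A.apply_symm_apply v

/-- A form vanishes on the common kernel of 1-forms iff all its coordinate expressions do. -/
theorem forall_ker_iff_inChart (α : Fin k → RawForm E M 1) (η : RawForm E M n) :
    (∀ (x : M) (v : Fin n → TangentSpace 𝓘(ℝ, E) x), (∀ s i, (α i x fun _ => v s) = 0) →
      η x v = 0) ↔
    ∀ c : M, ∀ y ∈ (extChartAt 𝓘(ℝ, E) c).target, ∀ w : Fin n → E,
      (∀ s i, ((α i).inChart c y fun _ => w s) = 0) → η.inChart c y w = 0 := by
  constructor
  · intro h c y hy w hw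
    exact h _ _ hw
  · intro h
    refine forall_of_chart (E := E) fun c y hy v hv => ?_
    choose w hw using fun s => chartSymmD_surjective c hy (v s)
    have h1 := h c y hy w fun s i => by
      rw [inChart_apply]
      exact (congrArg (fun z => α i _ fun _ => z) (hw s)).trans (hv s i)
    rw [inChart_apply] at h1
    exact (congrArg (η _) (funext hw)).symm.trans h1

theorem Form.eq_zero_iff_inChart (η : Form E M n) :
    η = 0 ↔ ∀ c : M, ∀ y ∈ (extChartAt 𝓘(ℝ, E) c).target, η.1.inChart c y = 0 := by
  constructor
  · rintro rfl c y hy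
    rfl
  · intro h
    have := (forall_ker_iff_inChart (fun i : Fin 0 => i.elim0) η.1).2 fun c y hy w _ => by
      rw [h c y hy]; rfl
    apply Subtype.ext
    funext x
    ext v
    exact this x v fun s i => i.elim0

/-- The product of a form with a smooth function. -/
noncomputable def Form.smulFun (g : M → ℝ)
    (hg : ∀ c : M, ContDiffOn ℝ ∞ (g ∘ (extChartAt 𝓘(ℝ, E) c).symm) (extChartAt 𝓘(ℝ, E) c).target)
    (η : Form E M n) : Form E M n :=
  ⟨fun x => g x • η.1 x, fun c => (hg c).smul (η.2 c)⟩

section Dual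

/-- The coordinate expression of a vector field in the preferred chart at `c`. -/
noncomputable def fieldInChart (X : (x : M) → TangentSpace 𝓘(ℝ, E) x) (c : M) : E → E :=
  VectorField.mpullback 𝓘(ℝ, E) 𝓘(ℝ, E) (extChartAt 𝓘(ℝ, E) c).symm X

theorem contDiffOn_fieldInChart [CompleteSpace E]
    (X : Cₛ^∞⟮𝓘(ℝ, E); E, (TangentSpace 𝓘(ℝ, E) : M → Type _)⟯) (c : M) :
    ContDiffOn ℝ ∞ (fieldInChart X c) (extChartAt 𝓘(ℝ, E) c).target := by
  have : IsManifold 𝓘(ℝ, E) 1 M := IsManifold.of_le (n := ∞) (by simp)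
  intro y hy
  have h := ContMDiffAt.mpullback_vectorField_preimage (m := ∞) (n := ∞)
    (X.contMDiff ((extChartAt 𝓘(ℝ, E) c).symm y)) (contMDiffAt_extChartAt_symm' c hy)
    (isInvertible_mfderiv_extChartAt_symm c hy) (by simp)
  exact (contMDiffAt_vectorSpace_iff_contDiffAt.1 h).contDiffWithinAt

theorem chartSymmD_fieldInChart (X : (x : M) → TangentSpace 𝓘(ℝ, E) x) (c : M) {y : E}
    (hy : y ∈ (extChartAt 𝓘(ℝ, E) c).target) :
    chartSymmD c y (fieldInChart X c y) = X ((extChartAt 𝓘(ℝ, E) c).symm y) :=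
  congrArg (fun A => A (X ((extChartAt 𝓘(ℝ, E) c).symm y)))
    (isInvertible_mfderiv_extChartAt_symm c hy).self_comp_inverse

theorem inChart_fieldInChart (η : RawForm E M n)
    (X : Fin n → (x : M) → TangentSpace 𝓘(ℝ, E) x) (c : M) {y : E}
    (hy : y ∈ (extChartAt 𝓘(ℝ, E) c).target) :
    (η.inChart c y fun s => fieldInChart (X s) c y) =
      η ((extChartAt 𝓘(ℝ, E) c).symm y) fun s => X s ((extChartAt 𝓘(ℝ, E) c).symm y) := by
  rw [inChart_apply]
  exact congrArg (η _) (funext fun s => chartSymmD_fieldInChart (X s) c hy)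

theorem interior_inChart [CompleteSpace E]
    (X : Cₛ^∞⟮𝓘(ℝ, E); E, (TangentSpace 𝓘(ℝ, E) : M → Type _)⟯)
    (η : Form E M (n + 1)) (c : M) {y : E} (hy : y ∈ (extChartAt 𝓘(ℝ, E) c).target) :
    (Form.interior X η).1.inChart c y = (η.1.inChart c y).curryLeft (fieldInChart X c y) := by
  ext v
  change (η.1 ((extChartAt 𝓘(ℝ, E) c).symm y) : E [⋀^Fin (n + 1)]→L[ℝ] ℝ)
      (Matrix.vecCons (X ((extChartAt 𝓘(ℝ, E) c).symm y) : E) (chartSymmD c y ∘ v)) =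
    (η.1 ((extChartAt 𝓘(ℝ, E) c).symm y) : E [⋀^Fin (n + 1)]→L[ℝ] ℝ)
      (chartSymmD c y ∘ Matrix.vecCons (fieldInChart X c y) v)
  congr 1
  funext i
  refine Fin.cases ?_ (fun i => ?_) i
  · exact (chartSymmD_fieldInChart X c hy).symm
  · rfl

variable {α : Fin k → Form E M 1}
  {X : Fin k → Cₛ^∞⟮𝓘(ℝ, E); E, (TangentSpace 𝓘(ℝ, E) : M → Type _)⟯}

theorem IsDual.inChart (hX : IsDual α X) (c : M) {y : E}
    (hy : y ∈ (extChartAt 𝓘(ℝ, E) c).target) (i j : Fin k) :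
    ((α i).1.inChart c y fun _ => fieldInChart (X j) c y) = if i = j then 1 else 0 :=
  (inChart_fieldInChart (α i).1 (fun _ => X j) c hy).trans (hX i j _)

/-- Equivalence of forms is equality of their restrictions to the leaves. -/
theorem mem_nullForms_iff (hX : IsDual α X) (η : Form E M n) :
    η ∈ nullForms α n ↔ ∀ (x : M) (v : Fin n → TangentSpace 𝓘(ℝ, E) x),
      (∀ s i, ((α i).1 x fun _ => v s) = 0) → η.1 x v = 0 :=
  forall_congr' fun x => wedgeAt_wedgeCovectors_eq_zero_iff (X := fun j => X j x)
    (fun i j => hX i j x) (η.1 x)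

theorem mem_nullForms_iff_inChart (hX : IsDual α X) (η : Form E M n) :
    η ∈ nullForms α n ↔ ∀ c : M, ∀ y ∈ (extChartAt 𝓘(ℝ, E) c).target, ∀ w : Fin n → E,
      (∀ s i, ((α i).1.inChart c y fun _ => w s) = 0) → η.1.inChart c y w = 0 :=
  (mem_nullForms_iff hX η).trans (forall_ker_iff_inChart (fun i => (α i).1) η.1)

/-- Since `α_i(X^i)` is constant, only the term `i_{X^i} dα_i` of Cartan's formula contributes to
`δ`. -/
theorem deltaForm_inChart [CompleteSpace E] (hX : IsDual α X) (c : M) {y : E}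
    (hy : y ∈ (extChartAt 𝓘(ℝ, E) c).target) :
    (deltaForm α X).1.inChart c y =
      -∑ i, (extDeriv ((α i).1.inChart c) y).curryLeft (fieldInChart (X i) c y) := by
  have h0 : ∀ i, (Form.d (Form.interior (X i) (α i))).1.inChart c y = 0 := fun i => by
    have h1 : (Form.interior (X i) (α i)).1.inChart c =ᶠ[𝓝 y]
        fun _ => ContinuousAlternatingMap.constOfIsEmpty ℝ E (Fin 0) (1 : ℝ) := by
      filter_upwards [(isOpen_extChartAt_target c).mem_nhds hy] with z hz
      rw [interior_inChart _ _ c hz]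
      ext v
      have := hX.inChart c hz i i
      rw [if_pos rfl] at this
      refine Eq.trans ?_ this
      rw [ContinuousAlternatingMap.curryLeft_apply_apply]
      congr 1
      funext l
      rw [Subsingleton.elim l 0]
      rfl
    refine (inChart_d _ c hy).trans ?_
    rw [h1.extDeriv_eq, extDeriv_constOfIsEmpty, fderiv_fun_const]
    ext v
    rfl
  have h2 : ∀ i, (Form.lieDerivative (X i) (α i)).1.inChart c y =
      (extDeriv ((α i).1.inChart c) y).curryLeft (fieldInChart (X i) c y) := fun i => by
    have h3 : (Form.lieDerivative (X i) (α i)).1.inChart c y =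
      (Form.interior (X i) (Form.d (α i))).1.inChart c y +
        (Form.d (Form.interior (X i) (α i))).1.inChart c y := rfl
    rw [h3, h0, add_zero, interior_inChart _ _ c hy]
    exact congrArg (fun T => ContinuousAlternatingMap.curryLeft T (fieldInChart (X i) c y))
      (inChart_d (α i) c hy)
  -- Coordinate expressions are linear in the form.
  let R : Form E M 1 →+ (E [⋀^Fin 1]→L[ℝ] ℝ) :=
    { toFun := fun η => η.1.inChart c y
      map_zero' := rfl
      map_add' := fun _ _ => rfl }
  have h4 : R (deltaForm α X) = -∑ i, R (Form.lieDerivative (X i) (α i)) := by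
    rw [deltaForm, map_neg, map_sum]
  exact h4.trans (congrArg Neg.neg (Finset.sum_congr rfl fun i _ => h2 i))

theorem deltaForm_inChart_apply [CompleteSpace E] (hX : IsDual α X) (c : M) {y : E}
    (hy : y ∈ (extChartAt 𝓘(ℝ, E) c).target) (u : E) :
    ((deltaForm α X).1.inChart c y fun _ => u) =
      ∑ i, extDeriv ((α i).1.inChart c) y ![u, fieldInChart (X i) c y] := by
  rw [deltaForm_inChart hX c hy, ContinuousAlternatingMap.neg_apply,
    ContinuousAlternatingMap.sum_apply, ← Finset.sum_neg_distrib]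
  refine Finset.sum_congr rfl fun i _ => ?_
  rw [curryLeft_apply_const, twoForm_swap _ u]

end Dual

/-! ### Null forms and closedness for generators of a foliation -/

section Generators
variable {F : (x : M) → Submodule ℝ (TangentSpace 𝓘(ℝ, E) x)}
  {α β : Fin k → Form E M 1}
  {X : Fin k → Cₛ^∞⟮𝓘(ℝ, E); E, (TangentSpace 𝓘(ℝ, E) : M → Type _)⟯}

theorem IsGenerators.extDeriv_inChart_eq_zero (hα : IsGenerators F α) (hX : IsDual α X) (c : M)
    {y : E} (hy : y ∈ (extChartAt 𝓘(ℝ, E) c).target) (i : Fin k) (w : Fin 2 → E)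
    (hw : ∀ s j, ((α j).1.inChart c y fun _ => w s) = 0) :
    extDeriv ((α i).1.inChart c) y w = 0 := by
  have h := (mem_nullForms_iff_inChart hX (Form.d (α i))).1 (hα.integrable i) c y hy w hw
  rwa [← inChart_d (α i) c hy]

/-- `π(δ)` is closed for the foliated differential. -/
theorem d_deltaForm_mem_nullForms [CompleteSpace E] (hα : IsGenerators F α) (hX : IsDual α X) :
    Form.d (deltaForm α X) ∈ nullForms α 2 := by
  refine (mem_nullForms_iff_inChart hX _).2 fun c y hy w hw => ?_
  have hnhds := (isOpen_extChartAt_target (I := 𝓘(ℝ, E)) c).mem_nhds hy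
  have h1 : (deltaForm α X).1.inChart c =ᶠ[𝓝 y] fun z =>
      -∑ i, (extDeriv ((α i).1.inChart c) z).curryLeft (fieldInChart (X i) c z) := by
    filter_upwards [hnhds] with z hz using deltaForm_inChart hX c hz
  have h2 : (Form.d (deltaForm α X)).1.inChart c y = extDeriv ((deltaForm α X).1.inChart c) y :=
    inChart_d _ c hy
  rw [h2, h1.extDeriv_eq]
  refine extDeriv_delta_eq_zero (fun i => ((α i).2 c).contDiffAt hnhds)
    (fun i => ((contDiffOn_fieldInChart (X i) c).contDiffAt hnhds).differentiableAt (by simp))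
    ?_ ?_ hw
  · filter_upwards [hnhds] with z hz using hX.inChart c hz
  · filter_upwards [hnhds] with z hz using hα.extDeriv_inChart_eq_zero hX c hz

/-- A multiple `g μ` of `μ = α₁ ∧ ⋯ ∧ α_k` is closed iff `dg + g δ` vanishes along the
foliation. -/
theorem d_wedge_eq_zero_iff [CompleteSpace E] (hα : IsGenerators F α) (hX : IsDual α X) {g : M → ℝ}
    (hg : ∀ c : M, ContDiffOn ℝ ∞ (g ∘ (extChartAt 𝓘(ℝ, E) c).symm) (extChartAt 𝓘(ℝ, E) c).target)
    (hβ : ∀ x, (Form.wedge β).1 x = g x • (Form.wedge α).1 x) :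
    Form.d (Form.wedge β) = 0 ↔ ∀ c : M, ∀ y ∈ (extChartAt 𝓘(ℝ, E) c).target, ∀ u : E,
      (∀ i, ((α i).1.inChart c y fun _ => u) = 0) →
      fderiv ℝ (g ∘ (extChartAt 𝓘(ℝ, E) c).symm) y u +
        g ((extChartAt 𝓘(ℝ, E) c).symm y) * ((deltaForm α X).1.inChart c y fun _ => u) = 0 := by
  rw [Form.eq_zero_iff_inChart]
  refine forall_congr' fun c => forall₂_congr fun y hy => ?_
  have hnhds := (isOpen_extChartAt_target (I := 𝓘(ℝ, E)) c).mem_nhds hy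
  have h1 : (Form.wedge β).1.inChart c = fun z => (g ∘ (extChartAt 𝓘(ℝ, E) c).symm) z •
      wedgeCovectors fun i => (α i).1.inChart c z := by
    funext z
    ext v
    exact congrArg (fun T : E [⋀^Fin k]→L[ℝ] ℝ => T fun s => chartSymmD c z (v s)) (hβ _)
  have h2 : (Form.d (Form.wedge β)).1.inChart c y = _ :=
    (inChart_d (Form.wedge β) c hy).trans (by rw [h1])
  have hdual := hX.inChart c hy
  have key := fun (u : E) (hu : ∀ i, ((α i).1.inChart c y fun _ => u) = 0) =>
    extDeriv_smul_wedgeCovectors_cons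
      (fun i => Form.differentiableAt_inChart (α i) hy)
      (Form.differentiableAt_inChart (Form.wedge α) hy)
      (((hg c).contDiffAt hnhds).differentiableAt (by simp)) hdual
      (hα.extDeriv_inChart_eq_zero hX c hy) hu
  rw [h2]
  simp only [← deltaForm_inChart_apply hX c hy] at key
  constructor
  · intro h u hu
    have h3 := key u hu fun j => fieldInChart (X j) c y
    rw [h, wedgeCovectors_dual hdual, mul_one] at h3
    exact h3.symm
  · intro h
    refine eq_zero_of_cons_mem_ker (fun i => (α i).1.inChart c y) _ fun u hu w => ?_
    rw [key u hu w]
    exact mul_eq_zero_of_left (h u hu) _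

end Generators
end Transfer

/-! ### Existence of dual vector fields -/

section Existence

variable {E : Type*} [NormedAddCommGroup E] [NormedSpace ℝ E] {k : ℕ}

/-- Smooth pointwise independent 1-forms on an open set have dual vector fields near each point,
obtained by inverting a matrix with smooth entries. -/
theorem exists_local_dual {a : Fin k → E → E [⋀^Fin 1]→L[ℝ] ℝ} {s : Set E} {y₀ : E}
    (ha : ∀ i, ContDiffOn ℝ ∞ (a i) s) (hs : IsOpen s)
    (hy₀ : y₀ ∈ s)
    (hli : LinearIndependent ℝ fun i => a i y₀) :
    ∃ t, IsOpen t ∧ y₀ ∈ t ∧ t ⊆ s ∧ ∃ Y : Fin k → E → E, (∀ j, ContDiffOn ℝ ∞ (Y j) t) ∧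
      ∀ y ∈ t, ∀ i j, (a i y fun _ => Y j y) = if i = j then 1 else 0 := by
  obtain ⟨v, hv⟩ := exists_dual_of_linearIndependent hli
  let A : E → Matrix (Fin k) (Fin k) ℝ := fun y => Matrix.of fun i l => a i y fun _ => v l
  have hA : ∀ i l, ContDiffOn ℝ ∞ (fun y => A y i l) s := fun i l =>
    contDiffOn_oneForm_apply (ha i) contDiffOn_const
  have hdet := contDiffOn_det hA
  have hdet0 : (A y₀).det ≠ 0 := by
    have : A y₀ = 1 := by
      ext i l
      simp [A, hv, Matrix.one_apply]
    simp [this]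
  have hadj : ∀ l j, ContDiffOn ℝ ∞ (fun y => (A y).adjugate l j) s := fun l j => by
    simp only [Matrix.adjugate_apply]
    refine contDiffOn_det fun i i' => ?_
    rcases eq_or_ne i j with rfl | hij
    · simpa using contDiffOn_const
    · simpa [hij] using hA i i'
  refine ⟨s ∩ {y | (A y).det ≠ 0}, hdet.continuousOn.isOpen_inter_preimage hs isOpen_ne,
    ⟨hy₀, hdet0⟩, Set.inter_subset_left,
    fun j y => ∑ l, ((A y).det⁻¹ * (A y).adjugate l j) • v l, fun j => ?_, fun y hy i j => ?_⟩
  · refine ContDiffOn.sum fun l _ => ContDiffOn.smul (ContDiffOn.mul ?_ ?_) contDiffOn_const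
    · exact (hdet.mono Set.inter_subset_left).inv fun y hy => hy.2
    · exact (hadj l j).mono Set.inter_subset_left
  · have h := congrFun (congrFun (Matrix.mul_adjugate (A y)) i) j
    rw [Matrix.mul_apply] at h
    rw [oneForm_sum]
    simp only [oneForm_smul]
    have h2 : ∀ l, (A y).det⁻¹ * (A y).adjugate l j * (a i y fun _ => v l) =
        (A y).det⁻¹ * (A y i l * (A y).adjugate l j) := fun l => by
      simp only [A, Matrix.of_apply]
      ring
    rw [Finset.sum_congr rfl fun l _ => h2 l, ← Finset.mul_sum, h]
    have hd : (A y).det ≠ 0 := hy.2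
    rw [Matrix.smul_apply, Matrix.one_apply]
    split_ifs <;> simp [hd]

variable {M : Type*} [TopologicalSpace M] [ChartedSpace E M] [IsManifold 𝓘(ℝ, E) ∞ M]

theorem mfderiv_extChartAt_inverse (c : M) {y : E} (hy : y ∈ (extChartAt 𝓘(ℝ, E) c).target) :
    (chartD E c ((extChartAt 𝓘(ℝ, E) c).symm y)).inverse = chartSymmD c y := by
  have : IsManifold 𝓘(ℝ, E) 1 M := IsManifold.of_le (n := ∞) (by simp)
  have h : chartD E c ((extChartAt 𝓘(ℝ, E) c).symm y) ∘L chartSymmD c y =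
      ContinuousLinearMap.id ℝ E := by
    have h := mfderiv_extChartAt_comp_mfderivWithin_extChartAt_symm (I := 𝓘(ℝ, E)) hy
    rwa [ModelWithCorners.range_eq_univ, mfderivWithin_univ] at h
  have hinv : (chartD E c ((extChartAt 𝓘(ℝ, E) c).symm y)).IsInvertible :=
    isInvertible_mfderiv_extChartAt ((extChartAt 𝓘(ℝ, E) c).map_target hy)
  obtain ⟨A, hA⟩ := hinv
  rw [← hA] at h ⊢
  rw [ContinuousLinearMap.inverse_equiv]
  ext v
  have h1 := DFunLike.congr_fun h v
  exact (A.symm_apply_eq).2 h1.symm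

theorem linearIndependent_inChart {α : Fin k → Form E M 1}
    (hα : ∀ x, LinearIndependent ℝ fun i => (α i).1 x) (c : M) {y : E}
    (hy : y ∈ (extChartAt 𝓘(ℝ, E) c).target) :
    LinearIndependent ℝ fun i => (α i).1.inChart c y := by
  refine Fintype.linearIndependent_iff.2 fun g hg i => ?_
  refine Fintype.linearIndependent_iff.1 (hα ((extChartAt 𝓘(ℝ, E) c).symm y)) g ?_ i
  ext v
  choose w hw using fun s => chartSymmD_surjective c hy (v s)
  have h := DFunLike.congr_fun hg w
  rw [ContinuousAlternatingMap.sum_apply] at h ⊢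
  refine Eq.trans (Finset.sum_congr rfl fun i _ => ?_) h
  exact congrArg (fun z => g i * (α i).1 _ z) (funext hw).symm

/-- Duality is a convex condition on the vector fields, so local solutions can be glued by a
partition of unity. -/
theorem exists_isDual [FiniteDimensional ℝ E] [T2Space M] [SigmaCompactSpace M]
    {α : Fin k → Form E M 1} (hα : ∀ x, LinearIndependent ℝ fun i => (α i).1 x) :
    ∃ X, IsDual α X := by
  have : IsManifold 𝓘(ℝ, E) 1 M := IsManifold.of_le (n := ∞) (by simp)
  have : CompleteSpace E := FiniteDimensional.complete ℝ E
  have key : ∀ j, ∃ X : Cₛ^∞⟮𝓘(ℝ, E); E, (TangentSpace 𝓘(ℝ, E) : M → Type _)⟯,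
      ∀ x, X x ∈ {v : TangentSpace 𝓘(ℝ, E) x |
        ∀ i, ((α i).1 x fun _ => v) = if i = j then 1 else 0} := fun j => by
    refine exists_contMDiffSection_forall_mem_convex_of_local 𝓘(ℝ, E)
      (TangentSpace 𝓘(ℝ, E) : M → Type _) _ (fun x u hu v hv p q _ _ hpq i => ?_) fun c => ?_
    · rw [oneForm_add, oneForm_smul, oneForm_smul, hu i, hv i, ← add_mul, hpq, one_mul]
    · obtain ⟨t, ht, hct, hts, Y, hY, hYd⟩ := exists_local_dual (fun i => (α i).2 c)
        (isOpen_extChartAt_target c) (mem_extChartAt_target c)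
        (linearIndependent_inChart hα c (mem_extChartAt_target c))
      refine ⟨(extChartAt 𝓘(ℝ, E) c).source ∩ extChartAt 𝓘(ℝ, E) c ⁻¹' t,
        ((continuousOn_extChartAt c).isOpen_inter_preimage (isOpen_extChartAt_source c) ht).mem_nhds
          ⟨mem_extChartAt_source c, hct⟩,
        VectorField.mpullback 𝓘(ℝ, E) 𝓘(ℝ, E) (extChartAt 𝓘(ℝ, E) c) (Y j),
        fun x hx => ?_, fun x hx i => ?_⟩
      · refine (ContMDiffAt.mpullback_vectorField_preimage (m := ∞) (n := ∞) ?_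
          (contMDiffAt_extChartAt' (by simpa using hx.1)) (isInvertible_mfderiv_extChartAt hx.1)
          (by simp)).contMDiffWithinAt
        exact contMDiffAt_vectorSpace_iff_contDiffAt.2 ((hY j).contDiffAt (ht.mem_nhds hx.2))
      · have hy := (extChartAt 𝓘(ℝ, E) c).map_source hx.1
        have hpull : ∀ y ∈ (extChartAt 𝓘(ℝ, E) c).target, y ∈ t →
            ((α i).1 ((extChartAt 𝓘(ℝ, E) c).symm y) fun _ => VectorField.mpullback 𝓘(ℝ, E) 𝓘(ℝ, E)
              (extChartAt 𝓘(ℝ, E) c) (Y j) ((extChartAt 𝓘(ℝ, E) c).symm y)) =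
            if i = j then 1 else 0 := fun y hy hyt => by
          rw [← hYd y hyt i j, inChart_apply]
          refine congrArg ((α i).1 _) (funext fun _ => ?_)
          refine (congrArg (fun A : E →L[ℝ] E => A _) (mfderiv_extChartAt_inverse c hy)).trans ?_
          rw [(extChartAt 𝓘(ℝ, E) c).right_inv hy]
        have h := hpull _ hy hx.2
        rwa [(extChartAt 𝓘(ℝ, E) c).left_inv hx.1] at h
  choose X hX using key
  exact ⟨X, fun i j x => hX j x i⟩

end Existence

/-! ### The obstruction class and closed products of generators -/

section Class

variable {E : Type*} [NormedAddCommGroup E] [NormedSpace ℝ E]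
  {M : Type*} [TopologicalSpace M] [ChartedSpace E M]

theorem zeroForm_inChart (φ : RawForm E M 0) (c : M) : φ.inChart c = fun y =>
    ContinuousAlternatingMap.constOfIsEmpty ℝ E (Fin 0)
      (((fun x => φ x 0) ∘ (extChartAt 𝓘(ℝ, E) c).symm) y) := by
  funext y
  ext v
  rw [inChart_apply]
  exact congrArg (φ _) (Subsingleton.elim _ _)

theorem Form.contDiffOn_zeroForm (φ : Form E M 0) (c : M) :
    ContDiffOn ℝ ∞ ((fun x => φ.1 x 0) ∘ (extChartAt 𝓘(ℝ, E) c).symm)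
      (extChartAt 𝓘(ℝ, E) c).target := by
  let S : (E [⋀^Fin 0]→L[ℝ] ℝ) →L[ℝ] ℝ :=
    (ContinuousAlternatingMap.constOfIsEmptyLIE ℝ E ℝ (Fin 0)).symm.toContinuousLinearEquiv
  have h : ContDiffOn ℝ ∞ (fun y => S (φ.1.inChart c y)) (extChartAt 𝓘(ℝ, E) c).target :=
    S.contDiff.comp_contDiffOn (φ.2 c)
  refine h.congr fun y hy => ?_
  rw [zeroForm_inChart]
  rfl

variable [IsManifold 𝓘(ℝ, E) ∞ M] {k : ℕ}
  {F : (x : M) → Submodule ℝ (TangentSpace 𝓘(ℝ, E) x)} {α β : Fin k → Form E M 1}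

theorem Form.d_zeroForm_inChart_apply (φ : Form E M 0) (c : M) {y : E}
    (hy : y ∈ (extChartAt 𝓘(ℝ, E) c).target) (u : E) :
    ((Form.d φ).1.inChart c y fun _ => u) =
      fderiv ℝ ((fun x => φ.1 x 0) ∘ (extChartAt 𝓘(ℝ, E) c).symm) y u := by
  have h : (Form.d φ).1.inChart c y = _ := inChart_d φ c hy
  rw [h, zeroForm_inChart, extDeriv_constOfIsEmpty]
  rfl

/-- A smooth function on a manifold, as a 0-form. -/
noncomputable def Form.ofFun (g : M → ℝ)
    (hg : ∀ c : M, ContDiffOn ℝ ∞ (g ∘ (extChartAt 𝓘(ℝ, E) c).symm)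
      (extChartAt 𝓘(ℝ, E) c).target) : Form E M 0 :=
  ⟨fun x => ContinuousAlternatingMap.constOfIsEmpty ℝ (TangentSpace 𝓘(ℝ, E) x) (Fin 0) (g x),
    fun c => by
      let S : ℝ →L[ℝ] (E [⋀^Fin 0]→L[ℝ] ℝ) :=
        (ContinuousAlternatingMap.constOfIsEmptyLIE ℝ E ℝ (Fin 0)).toContinuousLinearEquiv
      have h : ContDiffOn ℝ ∞ (fun y => S ((g ∘ (extChartAt 𝓘(ℝ, E) c).symm) y))
        (extChartAt 𝓘(ℝ, E) c).target := S.contDiff.comp_contDiffOn (hg c)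
      exact h⟩

/-- Rescaling generators by nowhere vanishing functions gives generators of the same foliation. -/
theorem IsGenerators.smulFun (hα : IsGenerators F α)
    {X : Fin k → Cₛ^∞⟮𝓘(ℝ, E); E, (TangentSpace 𝓘(ℝ, E) : M → Type _)⟯} (hX : IsDual α X)
    (g : Fin k → M → ℝ)
    (hg : ∀ i, ∀ c : M, ContDiffOn ℝ ∞ (g i ∘ (extChartAt 𝓘(ℝ, E) c).symm)
      (extChartAt 𝓘(ℝ, E) c).target) (hg0 : ∀ i x, g i x ≠ 0) :
    IsGenerators F (fun i => Form.smulFun (g i) (hg i) (α i)) ∧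
    ∀ x, (Form.wedge fun i => Form.smulFun (g i) (hg i) (α i)).1 x =
      (∏ i, g i x) • (Form.wedge α).1 x := by
  have hw : ∀ x, (Form.wedge fun i => Form.smulFun (g i) (hg i) (α i)).1 x =
      (∏ i, g i x) • (Form.wedge α).1 x := fun x => by
    ext v
    exact Matrix.det_mul_row (fun i => g i x) (Matrix.of fun j i => (α i).1 x fun _ => v j)
  refine ⟨⟨fun x => ?_, fun i x => ?_, fun x v => ?_⟩, hw⟩
  · exact (hα.independent x).units_smul fun i => Units.mk0 (g i x) (hg0 i x)
  · have hnull : Form.d (Form.smulFun (g i) (hg i) (α i)) ∈ nullForms α 2 := by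
      refine (mem_nullForms_iff_inChart hX _).2 fun c y hy w hw => ?_
      have h : (Form.d (Form.smulFun (g i) (hg i) (α i))).1.inChart c y = _ :=
        inChart_d (Form.smulFun (g i) (hg i) (α i)) c hy
      rw [h]
      exact extDeriv_smul_oneForm_eq_zero (Form.differentiableAt_inChart (α i) hy)
        (((hg i c).contDiffAt ((isOpen_extChartAt_target c).mem_nhds hy)).differentiableAt
          (by simp)) (fun s => hw s i) (hα.extDeriv_inChart_eq_zero hX c hy i w hw)
    refine (wedgeAt_wedgeCovectors_eq_zero_iff (X := fun j => (g j x)⁻¹ • X j x)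
      (fun i j => ?_) _).2 fun v hv => (mem_nullForms_iff hX _).1 hnull x v fun s j => ?_
    · change g i x * ((α i).1 x fun _ => (g j x)⁻¹ • X j x) = _
      rw [oneForm_smul, hX]
      split_ifs with hij
      · subst hij
        simp [hg0]
      · simp
    · exact (mul_eq_zero.1 (hv s j)).resolve_left (hg0 j x)
  · rw [hα.mem_iff]
    refine forall_congr' fun i => ?_
    change _ ↔ g i x * _ = 0
    simp [hg0]

variable [CompleteSpace E] {X : Fin k → Cₛ^∞⟮𝓘(ℝ, E); E, (TangentSpace 𝓘(ℝ, E) : M → Type _)⟯}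

/-- The obstruction class vanishes iff `δ` is the differential of a function along the leaves. -/
theorem obstructionClass_eq_zero_iff (hX : IsDual α X)
    (h : toFoliated α 1 (deltaForm α X) ∈ foliatedCocycles α 1) :
    obstructionClass α X h = 0 ↔ ∃ φ : Form E M 0, ∀ c : M,
      ∀ y ∈ (extChartAt 𝓘(ℝ, E) c).target, ∀ u : E,
      (∀ i, ((α i).1.inChart c y fun _ => u) = 0) →
      fderiv ℝ ((fun x => φ.1 x 0) ∘ (extChartAt 𝓘(ℝ, E) c).symm) y u =
        (deltaForm α X).1.inChart c y fun _ => u := by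
  rw [obstructionClass, Submodule.Quotient.mk_eq_zero]
  change toFoliated α 1 (deltaForm α X) ∈ foliatedCoboundaries α 0 ↔ _
  refine exists_congr fun φ => ?_
  change Submodule.Quotient.mk _ = Submodule.Quotient.mk _ ↔ _
  rw [Submodule.Quotient.eq, mem_nullForms_iff_inChart hX]
  refine forall_congr' fun c => forall₂_congr fun y hy => ?_
  have hsub : ∀ w : Fin 1 → E, (Form.d φ - deltaForm α X).1.inChart c y w =
      (Form.d φ).1.inChart c y w - (deltaForm α X).1.inChart c y w := fun w => rfl
  constructor
  · intro h u hu
    rw [← Form.d_zeroForm_inChart_apply φ c hy, ← sub_eq_zero, ← hsub]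
    exact h _ fun _ => hu
  · intro h (w : Fin 1 → E) hw
    have hw1 : w = fun _ => w 0 := funext fun l => by rw [Subsingleton.elim l 0]
    rw [hsub, sub_eq_zero, hw1, Form.d_zeroForm_inChart_apply φ c hy]
    exact h _ (hw 0)

/-- If `δ = dφ` along the foliation, rescaling one generator by `e^{-φ}` makes the product
closed. -/
theorem exists_closed_generators (hα : IsGenerators F α) (hX : IsDual α X) (φ : Form E M 0)
    (hφ : ∀ c : M, ∀ y ∈ (extChartAt 𝓘(ℝ, E) c).target, ∀ u : E,
      (∀ i, ((α i).1.inChart c y fun _ => u) = 0) →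
      fderiv ℝ ((fun x => φ.1 x 0) ∘ (extChartAt 𝓘(ℝ, E) c).symm) y u =
        (deltaForm α X).1.inChart c y fun _ => u) :
    ∃ β : Fin k → Form E M 1, IsGenerators F β ∧ Form.d (Form.wedge β) = 0 := by
  cases k with
  | zero =>
    -- There is nothing to rescale, but then `δ` is an empty sum.
    refine ⟨α, hα, (d_wedge_eq_zero_iff hα hX (g := fun _ => 1) (fun c => contDiffOn_const)
      fun x => (one_smul ℝ _).symm).2 fun c y hy u _ => ?_⟩
    rw [deltaForm_inChart_apply hX c hy]
    have : ((fun _ => 1 : M → ℝ) ∘ (extChartAt 𝓘(ℝ, E) c).symm) = fun _ => (1 : ℝ) := rfl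
    rw [this]
    simp
  | succ n =>
    let f : M → ℝ := fun x => φ.1 x 0
    let g : Fin (n + 1) → M → ℝ := Fin.cons (fun x => Real.exp (-f x)) fun _ _ => 1
    have hexp : ∀ c : M, ContDiffOn ℝ ∞ ((fun x => Real.exp (-f x)) ∘
        (extChartAt 𝓘(ℝ, E) c).symm) (extChartAt 𝓘(ℝ, E) c).target := fun c =>
      (Form.contDiffOn_zeroForm φ c).neg.exp
    obtain ⟨hβ, hw⟩ := hα.smulFun hX g
      (fun i c => by
        refine Fin.cases ?_ (fun i => ?_) i
        · exact hexp c
        · exact contDiffOn_const)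
      (fun i x => by
        refine Fin.cases ?_ (fun i => ?_) i
        · exact (Real.exp_pos _).ne'
        · exact one_ne_zero)
    refine ⟨_, hβ, (d_wedge_eq_zero_iff hα hX hexp fun x => ?_).2 fun c y hy u hu => ?_⟩
    · rw [hw x, Fin.prod_univ_succ]
      simp [g]
    · have hd : HasFDerivAt (f ∘ (extChartAt 𝓘(ℝ, E) c).symm)
          (fderiv ℝ (f ∘ (extChartAt 𝓘(ℝ, E) c).symm) y) y :=
        (((Form.contDiffOn_zeroForm φ c).contDiffAt
          ((isOpen_extChartAt_target c).mem_nhds hy)).differentiableAt (by simp)).hasFDerivAt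
      have h1 : fderiv ℝ ((fun x => Real.exp (-f x)) ∘ (extChartAt 𝓘(ℝ, E) c).symm) y = _ :=
        hd.neg.exp.fderiv
      rw [h1, ← hφ c y hy u hu]
      simp [f]

/-- If generators `β` have a closed product `h μ`, then `δ = d(-log |h|)` along the foliation. -/
theorem exists_potential (hα : IsGenerators F α) (hX : IsDual α X) (hβ : IsGenerators F β)
    (hd : Form.d (Form.wedge β) = 0) :
    ∃ φ : Form E M 0, ∀ c : M, ∀ y ∈ (extChartAt 𝓘(ℝ, E) c).target, ∀ u : E,
      (∀ i, ((α i).1.inChart c y fun _ => u) = 0) →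
      fderiv ℝ ((fun x => φ.1 x 0) ∘ (extChartAt 𝓘(ℝ, E) c).symm) y u =
        (deltaForm α X).1.inChart c y fun _ => u := by
  let h : M → ℝ := fun x => (Form.wedge β).1 x fun j => X j x
  have hker : ∀ x (v : TangentSpace 𝓘(ℝ, E) x),
      (∀ i, ((α i).1 x fun _ => v) = 0) ↔ ∀ i, ((β i).1 x fun _ => v) = 0 := fun x v =>
    (hα.mem_iff x v).symm.trans (hβ.mem_iff x v)
  have hw : ∀ x, (Form.wedge β).1 x = h x • (Form.wedge α).1 x := fun x =>
    wedgeCovectors_eq_mul (fun i j => hX i j x) fun v => (hker x v).1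
  have h0 : ∀ x, h x ≠ 0 := fun x =>
    wedgeCovectors_ne_zero (fun i j => hX i j x) fun v => (hker x v).2
  have hh : ∀ c : M, ContDiffOn ℝ ∞ (h ∘ (extChartAt 𝓘(ℝ, E) c).symm)
      (extChartAt 𝓘(ℝ, E) c).target := fun c => by
    have h1 : ContDiffOn ℝ ∞ (fun y => (Matrix.of fun j i => (β i).1.inChart c y
        fun _ => fieldInChart (X j) c y).det) (extChartAt 𝓘(ℝ, E) c).target :=
      contDiffOn_det fun j i =>
        contDiffOn_oneForm_apply (θ := (β i).1.inChart c) ((β i).2 c)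
          (contDiffOn_fieldInChart (X j) c)
    refine h1.congr fun y hy => ?_
    exact (inChart_fieldInChart (Form.wedge β).1 (fun j => X j) c hy).symm
  have hclosed := (d_wedge_eq_zero_iff hα hX hh hw).1 hd
  -- `Real.log` takes the value `log |h|` also where `h` is negative, and is smooth away from zero.
  refine ⟨Form.ofFun (fun x => -Real.log (h x)) fun c => ((hh c).log fun y _ => h0 _).neg,
    fun c y hy u hu => ?_⟩
  have hdiff := (((hh c).contDiffAt ((isOpen_extChartAt_target c).mem_nhds hy)).differentiableAt
    (by simp)).hasFDerivAt
  have h1 : fderiv ℝ ((fun x => -Real.log (h x)) ∘ (extChartAt 𝓘(ℝ, E) c).symm) y = _ :=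
    (hdiff.log (h0 _)).neg.fderiv
  have h2 := hclosed c y hy u hu
  refine (DFunLike.congr_fun h1 u).trans ?_
  have h3 := h0 ((extChartAt 𝓘(ℝ, E) c).symm y)
  change -((h ((extChartAt 𝓘(ℝ, E) c).symm y))⁻¹ * fderiv ℝ _ y u) = _
  rw [eq_neg_of_add_eq_zero_left h2]
  field_simp

end Class
end FoliatedForms

theorem mainTheorem1 {m k : ℕ} {M : Type*} [TopologicalSpace M] [T2Space M] [SigmaCompactSpace M]
    [ChartedSpace (EuclideanSpace ℝ (Fin m)) M]
    [IsManifold 𝓘(ℝ, EuclideanSpace ℝ (Fin m)) ∞ M]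
    (F : (x : M) → Submodule ℝ (TangentSpace 𝓘(ℝ, EuclideanSpace ℝ (Fin m)) x))
    (α : Fin k → FoliatedForms.Form (EuclideanSpace ℝ (Fin m)) M 1)
    (hα : FoliatedForms.IsGenerators F α) :
    (∃ X, FoliatedForms.IsDual α X) ∧
    ∀ X, FoliatedForms.IsDual α X →
      ∃ h : FoliatedForms.toFoliated α 1 (FoliatedForms.deltaForm α X) ∈
          FoliatedForms.foliatedCocycles α 1,
        (FoliatedForms.obstructionClass α X h = 0 ↔
          ∃ β : Fin k → FoliatedForms.Form (EuclideanSpace ℝ (Fin m)) M 1,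
            FoliatedForms.IsGenerators F β ∧
              FoliatedForms.Form.d (FoliatedForms.Form.wedge β) = 0) := by
  obtain ⟨X₀, hX₀⟩ := FoliatedForms.exists_isDual hα.independent
  refine ⟨⟨X₀, hX₀⟩, fun X hX => ?_⟩
  have hmem : FoliatedForms.toFoliated α 1 (FoliatedForms.deltaForm α X) ∈
      FoliatedForms.foliatedCocycles α 1 :=
    ⟨FoliatedForms.deltaForm α X, (Submodule.Quotient.mk_eq_zero _).2
      (FoliatedForms.d_deltaForm_mem_nullForms hα hX), rfl⟩
  refine ⟨hmem, (FoliatedForms.obstructionClass_eq_zero_iff hX hmem).trans ⟨?_, ?_⟩⟩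
  · rintro ⟨φ, hφ⟩
    exact FoliatedForms.exists_closed_generators hα hX φ hφ
  · rintro ⟨β, hβ, hd⟩
    exact FoliatedForms.exists_potential hα hX hβ hd
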